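/- Let $A$ be a ring, regarded as a dg algebra concentrated in cohomological degree $0$ with zero differential; dg modules over $A$ are then cochain complexes of left $A$-modules. Call an object $M$ of an additive category with arbitrary direct sums compact if $\bigoplus_{i\in I}\mathrm{Hom}(M,N_i)\to\mathrm{Hom}(M,\bigoplus_{i\in I}N_i)$ is an isomorphism for every family $(N_i)_{i\in I}$ of objects indexed by a set. (1) Suppose $A$ is left Noetherian. Let $K_0^{dg}(A)$ be the Grothendieck group of the category of compact objects of the derived category $D(A)$ of dg $A$-modules: the abelian group with generators $[M]$, over compact objects $M$, and relations $[M_2]=[M_1]+[M_3]$ for each distinguished triangle $M_1\to M_2\to M_3\to M_1[1]$ of compact objects, and $[M[1]]=-[M]$. Let $K_0(A)$ be the classical Grothendieck group of finitely generated projective left $A$-modules: generators $[P]$, relations $[P]=[P']+[P'']$ whenever $P\cong P'\oplus P''$. Then every finitely generated projective module $P$, placed in cohomological degree $0$, is compact in $D(A)$, and $[P]\mapsto[P]$ defines an isomorphism of abelian groups $K_0(A)\cong K_0^{dg}(A)$. (2) Suppose $A=\bigoplus_{i\in\mathbb Z}A_i$ is a $\mathbb Z$-graded ring which is left graded Noetherian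 (every homogeneous left ideal is finitely generated). Let $D(A)$ be the derived category of graded dg $A$-modules, that is, of cochain complexes of graded left $A$-modules with degree-preserving differentials, and let $\{n\}$ be the shift of the internal grading by $n$ degrees up, $(M\{n\})_k=M_{k-n}$. Let $K_0^{dg}(A)$ be the $\mathbb Z[q,q^{-1}]$-module with generators $[M]$, over compact objects $M$ of $D(A)$, and relations $[M_2]=[M_1]+[M_3]$ for each distinguished triangle $M_1\to M_2\to M_3\to M_1[1]$ of compact objects, $[M[1]]=-[M]$, and $[M\{n\}]=q^n[M]$. Let $K_0(A)$ be the $\mathbb Z[q,q^{-1}]$-module with generators $[P]$, over finitely generated graded projective left $A$-modules $P$, and relations $[P]=[P']+[P'']$ whenever $P\cong P'\oplus P''$ as graded modules, and $[P\{n\}]=q^n[P]$. Then every finitely generated graded projective module $P$, placed in cohomological degree $0$, is compact in $D(A)$, and $[P]\mapsto[P]$ defines an isomorphism of $\mathbb Z[q,q^{-1}]$-modules $K_0(A)\cong K_0^{dg}(A)$. -/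

import Mathlib

open CategoryTheory Limits Pretriangulated
open scoped LaurentPolynomial

universe w t u

/-! ### The category of graded left modules over a `ℤ`-graded ring -/

/-- An additive group with candidate components `gr` and projections onto them is the internal
direct sum of the `gr i`. -/
theorem isInternal_of_proj {M : Type*} [AddCommGroup M] (gr : ℤ → AddSubgroup M)
    (π : ℤ → M →+ M) (h1 : ∀ i, ∀ m ∈ gr i, π i m = m)
    (h2 : ∀ i j, i ≠ j → ∀ m ∈ gr j, π i m = 0) (h3 : ∀ m, m ∈ ⨆ i, gr i) :
    DirectSum.IsInternal gr := by
  classical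
  constructor
  · rw [injective_iff_map_eq_zero]
    intro x hx
    have key : ∀ i (y : DirectSum ℤ fun i => gr i),
        π i (DirectSum.coeAddMonoidHom gr y) = y i := by
      intro i y
      induction y using DirectSum.induction_on with
      | zero => simp
      | of j m =>
        rw [DirectSum.coeAddMonoidHom_of]
        by_cases h : i = j
        · subst h; rw [h1 _ _ m.2, DirectSum.of_eq_same]
        · rw [h2 _ _ h _ m.2, DirectSum.of_eq_of_ne _ _ _ h]; rfl
      | add a b ha hb => simp only [map_add, ha, hb, DirectSum.add_apply, AddSubgroup.coe_add]
    ext i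
    rw [← key i x, show DirectSum.coeAddMonoidHom gr x = 0 from hx]; simp
  · intro m
    have : (⨆ i, gr i) ≤ (DirectSum.coeAddMonoidHom gr).range := by
      refine iSup_le fun i m hm => ⟨DirectSum.of (fun i => gr i) i ⟨m, hm⟩, ?_⟩
      rw [DirectSum.coeAddMonoidHom_of]
    exact this (h3 m)

/-- A graded left module over the graded ring `A = ⨁ 𝒜 i`: a left `A`-module `M` which is the
internal direct sum of additive subgroups `gr j`, with `𝒜 i • gr j ⊆ gr (i + j)`. -/
structure GrMod {A : Type u} [Ring A] (𝒜 : ℤ → AddSubgroup A) : Type (u + 1) where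
  carrier : Type u
  [isAddCommGroup : AddCommGroup carrier]
  [isModule : Module A carrier]
  gr : ℤ → AddSubgroup carrier
  isInternal : DirectSum.IsInternal gr
  smul_mem : ∀ {i j : ℤ} {a : A} {m : carrier}, a ∈ 𝒜 i → m ∈ gr j → a • m ∈ gr (i + j)

namespace GrMod

attribute [instance] isAddCommGroup isModule

variable {A : Type u} [Ring A] {𝒜 : ℤ → AddSubgroup A}

/-- Morphisms of graded modules: `A`-linear maps preserving degrees. -/
@[ext]
structure Hom (M N : GrMod 𝒜) where
  lin : M.carrier →ₗ[A] N.carrier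
  map_mem : ∀ (i : ℤ) (m : M.carrier), m ∈ M.gr i → lin m ∈ N.gr i

instance : Category (GrMod 𝒜) where
  Hom M N := Hom M N
  id M := ⟨LinearMap.id, fun _ _ h => h⟩
  comp f g := ⟨g.lin ∘ₗ f.lin, fun i m h => g.map_mem i _ (f.map_mem i m h)⟩

@[ext]
theorem hom_ext {M N : GrMod 𝒜} {f g : M ⟶ N} (h : ∀ m, f.lin m = g.lin m) : f = g :=
  Hom.ext (LinearMap.ext h)

@[simp] theorem id_lin (M : GrMod 𝒜) : Hom.lin (𝟙 M) = LinearMap.id := rfl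

@[simp] theorem comp_lin {M N K : GrMod 𝒜} (f : M ⟶ N) (g : N ⟶ K) :
    (f ≫ g).lin = g.lin ∘ₗ f.lin := rfl

section Preadditive

variable (M N : GrMod 𝒜)

instance : Zero (M ⟶ N) := ⟨⟨0, fun i _ _ => (N.gr i).zero_mem⟩⟩
instance : Add (M ⟶ N) :=
  ⟨fun f g => ⟨f.lin + g.lin, fun i m h => (N.gr i).add_mem (f.map_mem i m h) (g.map_mem i m h)⟩⟩
instance : Neg (M ⟶ N) := ⟨fun f => ⟨-f.lin, fun i m h => (N.gr i).neg_mem (f.map_mem i m h)⟩⟩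
instance : Sub (M ⟶ N) :=
  ⟨fun f g => ⟨f.lin - g.lin, fun i m h => (N.gr i).sub_mem (f.map_mem i m h) (g.map_mem i m h)⟩⟩
instance : SMul ℕ (M ⟶ N) :=
  ⟨fun n f => ⟨n • f.lin, fun i m h => (N.gr i).nsmul_mem (f.map_mem i m h) n⟩⟩
instance : SMul ℤ (M ⟶ N) :=
  ⟨fun n f => ⟨n • f.lin, fun i m h => (N.gr i).zsmul_mem (f.map_mem i m h) n⟩⟩

theorem lin_injective : Function.Injective (fun f : M ⟶ N => f.lin) := fun _ _ h => Hom.ext h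

instance : AddCommGroup (M ⟶ N) :=
  (lin_injective M N).addCommGroup _ rfl (fun _ _ => rfl) (fun _ => rfl) (fun _ _ => rfl)
    (fun _ _ => rfl) (fun _ _ => rfl)

end Preadditive

@[simp] theorem zero_lin (M N : GrMod 𝒜) : (0 : M ⟶ N).lin = 0 := rfl
@[simp] theorem add_lin {M N : GrMod 𝒜} (f g : M ⟶ N) : (f + g).lin = f.lin + g.lin := rfl

instance : Preadditive (GrMod 𝒜) where
  add_comp _ _ _ f f' g := by ext m; exact map_add g.lin _ _
  comp_add _ _ _ f g g' := by ext m; rfl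

/-! Homogeneous components -/

/-- The projection of a graded module onto its component of degree `i`. -/
noncomputable def proj (M : GrMod 𝒜) (i : ℤ) : M.carrier →+ M.carrier :=
  letI := M.isInternal.chooseDecomposition
  ((M.gr i).subtype.comp (DFinsupp.evalAddMonoidHom i)).comp
    (DirectSum.decomposeAddEquiv M.gr).toAddMonoidHom

theorem proj_mem (M : GrMod 𝒜) (i : ℤ) (m : M.carrier) : M.proj i m ∈ M.gr i :=
  Subtype.property _

theorem proj_of_mem (M : GrMod 𝒜) {i : ℤ} {m : M.carrier} (h : m ∈ M.gr i) : M.proj i m = m :=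
  letI := M.isInternal.chooseDecomposition
  DirectSum.decompose_of_mem_same M.gr h

theorem proj_of_mem_ne (M : GrMod 𝒜) {i j : ℤ} (hij : i ≠ j) {m : M.carrier} (h : m ∈ M.gr j) :
    M.proj i m = 0 :=
  letI := M.isInternal.chooseDecomposition
  DirectSum.decompose_of_mem_ne M.gr h hij.symm

theorem exists_sum (M : GrMod 𝒜) (m : M.carrier) : ∃ s : Finset ℤ, ∑ i ∈ s, M.proj i m = m := by
  classical
  let := M.isInternal.chooseDecomposition
  exact ⟨_, DirectSum.sum_support_decompose M.gr m⟩

@[elab_as_elim]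
theorem induction_gr (M : GrMod 𝒜) {p : M.carrier → Prop} (h0 : p 0)
    (h : ∀ i, ∀ m ∈ M.gr i, p m) (ha : ∀ m n, p m → p n → p (m + n)) (m : M.carrier) : p m := by
  classical
  obtain ⟨s, hs⟩ := M.exists_sum m
  rw [← hs]
  exact Finset.sum_induction _ p ha h0 fun i _ => h i _ (M.proj_mem i m)

theorem proj_naturality {M N : GrMod 𝒜} (f : M ⟶ N) (i : ℤ) (m : M.carrier) :
    N.proj i (f.lin m) = f.lin (M.proj i m) := by
  induction m using M.induction_gr with
  | h0 => simp
  | h j m hm =>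
    by_cases hij : i = j
    · subst hij; rw [M.proj_of_mem hm, N.proj_of_mem (f.map_mem _ _ hm)]
    · rw [M.proj_of_mem_ne hij hm, N.proj_of_mem_ne hij (f.map_mem _ _ hm), map_zero]
  | ha a b ha hb => simp [ha, hb]

/-! Kernels, cokernels and biproducts -/

/-- The kernel of a morphism, graded by the intersections with the components. -/
noncomputable def ker {M N : GrMod 𝒜} (f : M ⟶ N) : GrMod 𝒜 where
  carrier := LinearMap.ker f.lin
  gr i := (M.gr i).comap (LinearMap.ker f.lin).subtype.toAddMonoidHom
  isInternal := by
    have hk : ∀ i (m : LinearMap.ker f.lin), M.proj i m ∈ LinearMap.ker f.lin := by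
      intro i m
      rw [LinearMap.mem_ker, ← proj_naturality, LinearMap.mem_ker.1 m.2, map_zero]
    refine isInternal_of_proj _
      (fun i => AddMonoidHom.mk' (fun m => ⟨M.proj i m, hk i m⟩) fun a b => Subtype.ext (by simp))
      ?_ ?_ ?_
    · intro i m hm; exact Subtype.ext (M.proj_of_mem hm)
    · intro i j hij m hm; exact Subtype.ext (M.proj_of_mem_ne hij hm)
    · intro m
      obtain ⟨s, hs⟩ := M.exists_sum m
      have : m = ∑ i ∈ s, (⟨M.proj i m, hk i m⟩ : LinearMap.ker f.lin) :=
        Subtype.ext (by simpa using hs.symm)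
      rw [this]
      exact sum_mem fun i _ => AddSubgroup.mem_iSup_of_mem i (M.proj_mem i m)
  smul_mem ha hm := M.smul_mem ha hm

/-- The inclusion of the kernel. -/
noncomputable def kerι {M N : GrMod 𝒜} (f : M ⟶ N) : ker f ⟶ M :=
  ⟨(LinearMap.ker f.lin).subtype, fun _ _ h => h⟩

/-- The universal property of the kernel. -/
noncomputable def kerIsLimit {M N : GrMod 𝒜} (f : M ⟶ N) :
    IsLimit (KernelFork.ofι (f := f) (kerι f) (by ext m; exact m.2)) :=
  KernelFork.IsLimit.ofι _ _
    (fun {W} g hg => ⟨g.lin.codRestrict _ fun x =>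
      LinearMap.mem_ker.2 (LinearMap.congr_fun (congrArg Hom.lin hg) x), fun i x hx =>
        g.map_mem i x hx⟩)
    (fun _ _ => rfl)
    (fun {W} g hg k hk => by
      ext x; exact Subtype.ext (LinearMap.congr_fun (congrArg Hom.lin hk) x))

/-- The cokernel of a morphism, graded by the images of the components. -/
noncomputable def coker {M N : GrMod 𝒜} (f : M ⟶ N) : GrMod 𝒜 where
  carrier := N.carrier ⧸ LinearMap.range f.lin
  gr i := (N.gr i).map (LinearMap.range f.lin).mkQ.toAddMonoidHom
  isInternal := by
    refine isInternal_of_proj _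
      (fun i => QuotientAddGroup.map (LinearMap.range f.lin).toAddSubgroup
        (LinearMap.range f.lin).toAddSubgroup (N.proj i) ?_) ?_ ?_ ?_
    · rintro _ ⟨m, rfl⟩
      exact ⟨M.proj i m, (proj_naturality f i m).symm⟩
    · rintro i _ ⟨m, hm, rfl⟩
      exact congrArg (LinearMap.range f.lin).mkQ (N.proj_of_mem hm)
    · rintro i j hij _ ⟨m, hm, rfl⟩
      exact (congrArg (LinearMap.range f.lin).mkQ (N.proj_of_mem_ne hij hm)).trans (map_zero _)
    · intro m
      obtain ⟨m, rfl⟩ := (LinearMap.range f.lin).mkQ_surjective m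
      induction m using N.induction_gr with
      | h0 => simp
      | h i m hm => exact AddSubgroup.mem_iSup_of_mem i ⟨m, hm, rfl⟩
      | ha a b ha hb => rw [map_add]; exact add_mem ha hb
  smul_mem := by
    rintro i j a _ ha ⟨m, hm, rfl⟩
    exact ⟨a • m, N.smul_mem ha hm, map_smul (LinearMap.range f.lin).mkQ a m⟩

/-- The projection to the cokernel. -/
noncomputable def cokerπ {M N : GrMod 𝒜} (f : M ⟶ N) : N ⟶ coker f :=
  ⟨(LinearMap.range f.lin).mkQ, fun _ m h => ⟨m, h, rfl⟩⟩

theorem comp_cokerπ {M N : GrMod 𝒜} (f : M ⟶ N) : f ≫ cokerπ f = 0 := by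
  ext m
  exact (Submodule.Quotient.mk_eq_zero _).2 ⟨m, rfl⟩

/-- The universal property of the cokernel. -/
noncomputable def cokerIsColimit {M N : GrMod 𝒜} (f : M ⟶ N) :
    IsColimit (CokernelCofork.ofπ (f := f) (cokerπ f) (comp_cokerπ f)) :=
  CokernelCofork.IsColimit.ofπ _ _
    (fun {W} g hg => ⟨(LinearMap.range f.lin).liftQ g.lin (by
        rintro _ ⟨m, rfl⟩
        exact LinearMap.congr_fun (congrArg Hom.lin hg) m), by
      rintro i _ ⟨m, hm, rfl⟩
      exact g.map_mem i m hm⟩)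
    (fun _ _ => rfl)
    (fun {W} g hg k hk => by
      ext x
      obtain ⟨x, rfl⟩ := (LinearMap.range f.lin).mkQ_surjective x
      exact LinearMap.congr_fun (congrArg Hom.lin hk) x)

instance : HasKernels (GrMod 𝒜) := ⟨fun f => ⟨⟨⟨_, kerIsLimit f⟩⟩⟩⟩
instance : HasCokernels (GrMod 𝒜) := ⟨fun f => ⟨⟨⟨_, cokerIsColimit f⟩⟩⟩⟩

/-- The direct sum of two graded modules. -/
def prod (M N : GrMod 𝒜) : GrMod 𝒜 where
  carrier := M.carrier × N.carrier
  gr i := (M.gr i).prod (N.gr i)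
  isInternal := by
    refine isInternal_of_proj _ (fun i => (M.proj i).prodMap (N.proj i)) ?_ ?_ ?_
    · rintro i m ⟨h1, h2⟩; exact Prod.ext (M.proj_of_mem h1) (N.proj_of_mem h2)
    · rintro i j hij m ⟨h1, h2⟩
      exact Prod.ext (M.proj_of_mem_ne hij h1) (N.proj_of_mem_ne hij h2)
    · rintro ⟨m, n⟩
      have : ((m, n) : M.carrier × N.carrier) = (m, 0) + (0, n) := by simp
      rw [this]
      refine add_mem ?_ ?_
      · clear this
        induction m using M.induction_gr with
        | h0 => exact zero_mem _
        | h i m hm => exact AddSubgroup.mem_iSup_of_mem i ⟨hm, zero_mem _⟩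
        | ha a b ha hb =>
          rw [show ((a + b, 0) : M.carrier × N.carrier) = (a, 0) + (b, 0) by simp]
          exact add_mem ha hb
      · clear this
        induction n using N.induction_gr with
        | h0 => exact zero_mem _
        | h i m hm => exact AddSubgroup.mem_iSup_of_mem i ⟨zero_mem _, hm⟩
        | ha a b ha hb =>
          rw [show ((0, a + b) : M.carrier × N.carrier) = (0, a) + (0, b) by simp]
          exact add_mem ha hb
  smul_mem ha hm := ⟨M.smul_mem ha hm.1, N.smul_mem ha hm.2⟩

instance : HasBinaryBiproducts (GrMod 𝒜) where
  has_binary_biproduct M N := hasBinaryBiproduct_of_total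
    { pt := prod M N
      fst := ⟨LinearMap.fst A _ _, fun _ _ h => h.1⟩
      snd := ⟨LinearMap.snd A _ _, fun _ _ h => h.2⟩
      inl := ⟨LinearMap.inl A _ _, fun _ _ h => ⟨h, zero_mem _⟩⟩
      inr := ⟨LinearMap.inr A _ _, fun _ _ h => ⟨zero_mem _, h⟩⟩
      inl_fst := rfl
      inl_snd := rfl
      inr_fst := rfl
      inr_snd := rfl } (by
        ext m
        exact Prod.ext (add_zero _) (zero_add _))

/-- The zero module. -/
def zeroObj : GrMod 𝒜 where
  carrier := PUnit
  gr _ := ⊤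
  isInternal := isInternal_of_proj _ (fun _ => 0) (fun _ _ _ => rfl) (fun _ _ _ _ _ => rfl)
    (fun _ => AddSubgroup.mem_iSup_of_mem 0 trivial)
  smul_mem _ _ := trivial

instance : HasZeroObject (GrMod 𝒜) :=
  ⟨zeroObj, (IsZero.iff_id_eq_zero _).2 (by ext m; rfl)⟩

instance : HasFiniteProducts (GrMod 𝒜) :=
  haveI : HasTerminal (GrMod 𝒜) := HasZeroObject.hasTerminal
  hasFiniteProducts_of_has_binary_and_terminal

theorem injective_of_mono {M N : GrMod 𝒜} (f : M ⟶ N) [Mono f] : Function.Injective f.lin := by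
  have h : kerι f = 0 := by
    rw [← cancel_mono f, zero_comp]; ext m; exact m.2
  rw [← LinearMap.ker_eq_bot, eq_bot_iff]
  intro m hm
  exact LinearMap.congr_fun (congrArg Hom.lin h) ⟨m, hm⟩

theorem surjective_of_epi {M N : GrMod 𝒜} (f : M ⟶ N) [Epi f] : Function.Surjective f.lin := by
  have h : cokerπ f = 0 := by
    rw [← cancel_epi f, comp_cokerπ, comp_zero]
  intro n
  exact (Submodule.Quotient.mk_eq_zero _).1 (LinearMap.congr_fun (congrArg Hom.lin h) n)

/-- A monomorphism is the kernel of its cokernel. -/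
@[reducible]
noncomputable def normalMono {M N : GrMod 𝒜} (f : M ⟶ N) [Mono f] : NormalMono f where
  Z := coker f
  g := cokerπ f
  w := comp_cokerπ f
  isLimit := by
    have hf := injective_of_mono f
    have hr : ∀ {W : GrMod 𝒜} (g : W ⟶ N), g ≫ cokerπ f = 0 → ∀ x, g.lin x ∈ LinearMap.range f.lin :=
      fun g hg x => (Submodule.Quotient.mk_eq_zero _).1
        (LinearMap.congr_fun (congrArg Hom.lin hg) x)
    let e := LinearEquiv.ofInjective f.lin hf
    have he : ∀ y, f.lin (e.symm y) = y := fun y => congrArg Subtype.val (e.apply_symm_apply y)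
    refine KernelFork.IsLimit.ofι _ _
      (fun {W} g hg => ⟨e.symm.toLinearMap ∘ₗ g.lin.codRestrict _ (hr g hg), ?_⟩) ?_ ?_
    · intro i x hx
      have hy := he ⟨g.lin x, hr g hg x⟩
      have : e.symm ⟨g.lin x, hr g hg x⟩ = M.proj i (e.symm ⟨g.lin x, hr g hg x⟩) := by
        apply hf
        rw [← proj_naturality, hy, N.proj_of_mem (g.map_mem i x hx)]
      change e.symm ⟨g.lin x, hr g hg x⟩ ∈ M.gr i
      rw [this]
      exact M.proj_mem _ _
    · intro W g hg
      ext x; exact he ⟨g.lin x, hr g hg x⟩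
    · intro W g hg k hk
      rw [← cancel_mono f, hk]
      ext x; exact (he ⟨g.lin x, hr g hg x⟩).symm

/-- An epimorphism is the cokernel of its kernel. -/
@[reducible]
noncomputable def normalEpi {M N : GrMod 𝒜} (f : M ⟶ N) [Epi f] : NormalEpi f where
  W := ker f
  g := kerι f
  w := by ext m; exact m.2
  isColimit := by
    have hf := surjective_of_epi f
    let e := f.lin.quotKerEquivOfSurjective hf
    have he : ∀ x, e.symm (f.lin x) = (LinearMap.ker f.lin).mkQ x := fun x => by
      rw [LinearEquiv.symm_apply_eq]; rfl
    have hk : ∀ {W : GrMod 𝒜} (g : M ⟶ W), kerι f ≫ g = 0 →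
        LinearMap.ker f.lin ≤ LinearMap.ker g.lin := fun g hg x hx =>
      LinearMap.congr_fun (congrArg Hom.lin hg) ⟨x, hx⟩
    refine CokernelCofork.IsColimit.ofπ _ _
      (fun {W} g hg => ⟨(LinearMap.ker f.lin).liftQ g.lin (hk g hg) ∘ₗ e.symm.toLinearMap, ?_⟩)
      ?_ ?_
    · intro i y hy
      obtain ⟨x, rfl⟩ := hf y
      have : f.lin x = f.lin (M.proj i x) := by rw [← proj_naturality, N.proj_of_mem hy]
      rw [this]
      change (LinearMap.ker f.lin).liftQ g.lin (hk g hg) (e.symm (f.lin (M.proj i x))) ∈ W.gr i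
      rw [he]
      exact g.map_mem i _ (M.proj_mem i x)
    · intro W g hg
      ext x
      change (LinearMap.ker f.lin).liftQ g.lin (hk g hg) (e.symm (f.lin x)) = g.lin x
      rw [he]; rfl
    · intro W g hg k hk'
      rw [← cancel_epi f, hk']
      ext x
      change _ = (LinearMap.ker f.lin).liftQ g.lin (hk g hg) (e.symm (f.lin x))
      rw [he]; rfl

noncomputable instance : Abelian (GrMod 𝒜) where
  normalMonoOfMono f _ := ⟨normalMono f⟩
  normalEpiOfEpi f _ := ⟨normalEpi f⟩
  has_finite_products := inferInstance

/-! The grading shift -/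

/-- The grading shift `M ↦ M{n}` by `n` degrees up: `(M{n})_k = M_{k - n}`. -/
def shiftObj (n : ℤ) (M : GrMod 𝒜) : GrMod 𝒜 where
  carrier := M.carrier
  gr k := M.gr (k - n)
  isInternal := by
    refine isInternal_of_proj _ (fun k => M.proj (k - n)) (fun i m hm => M.proj_of_mem hm)
      (fun i j hij m hm => M.proj_of_mem_ne (by omega) hm) fun m => ?_
    induction m using M.induction_gr with
    | h0 => exact zero_mem _
    | h i m hm => exact AddSubgroup.mem_iSup_of_mem (i + n) (by simpa using hm)
    | ha a b ha hb => exact add_mem ha hb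
  smul_mem {i j a m} ha hm := by
    have := M.smul_mem ha hm
    rwa [show i + j - n = i + (j - n) by ring]

/-- The grading shift as a functor. -/
def shift (𝒜 : ℤ → AddSubgroup A) (n : ℤ) : GrMod 𝒜 ⥤ GrMod 𝒜 where
  obj M := shiftObj n M
  map f := ⟨f.lin, fun k m h => f.map_mem (k - n) m h⟩

instance (n : ℤ) : (shift 𝒜 n).Additive where

instance (n : ℤ) : (shift 𝒜 n).Faithful where
  map_injective {M N} f g h := by
    have h' : ((shift 𝒜 n).map f).lin = ((shift 𝒜 n).map g).lin := congrArg Hom.lin h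
    exact Hom.ext h'

instance (n : ℤ) : (shift 𝒜 n).Full where
  map_surjective {M N} f := ⟨⟨f.lin, fun k m h => by
    have := f.map_mem (k + n) m (show m ∈ M.gr (k + n - n) by simpa using h)
    have h' : f.lin m ∈ N.gr (k + n - n) := this
    have hk : k + n - n = k := by ring
    rwa [hk] at h'⟩, rfl⟩

instance (n : ℤ) : (shift 𝒜 n).EssSurj where
  mem_essImage M := by
    have h : ∀ k, k - n - -n = k := fun k => by ring
    refine ⟨shiftObj (-n) M, ⟨⟨⟨LinearMap.id, fun k m hm => ?_⟩, ⟨LinearMap.id, fun k m hm => ?_⟩,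
      rfl, rfl⟩⟩⟩
    · have hm' : m ∈ M.gr (k - n - -n) := hm
      rwa [h] at hm'
    · change m ∈ M.gr (k - n - -n)
      rwa [h]

instance (n : ℤ) : (shift 𝒜 n).IsEquivalence where

end GrMod

/-- A graded ring is (left) graded Noetherian if all its homogeneous left ideals are finitely
generated. -/
def IsGradedNoetherian {A : Type u} [Ring A] (𝒜 : ℤ → AddSubgroup A) [GradedRing 𝒜] : Prop :=
  ∀ I : Ideal A, I.IsHomogeneous 𝒜 → I.FG

/-! ### Compact objects and Grothendieck groups -/

open Classical in
/-- `M` is compact if `⨁ Hom(M, N i) → Hom(M, ⨁ N i)` is an isomorphism for every family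
`(N i)_{i ∈ I}` of objects; here `c` is the direct sum (coproduct) of the family. -/
def isCompactObject (D : Type*) [Category* D] [Preadditive D] : ObjectProperty D := fun M =>
  ∀ (I : Type t) (N : I → D) (c : Cofan N), Nonempty (IsColimit c) →
    Function.Bijective
      (DirectSum.toAddMonoid (fun i => Preadditive.rightComp M (c.inj i)) :
        (DirectSum I fun i => (M ⟶ N i)) →+ (M ⟶ c.pt))

section Relations

variable (R : Type) [Ring R]

/-- The relations `[X₂] = [X₁] + [X₃]`, one for each distinguished triangle
`X₁ ⟶ X₂ ⟶ X₃ ⟶ X₁⟦1⟧` of objects of the full subcategory `P`, and `[X⟦1⟧] = -[X]`. -/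
def triangleRelations {D : Type*} [Category* D] [Preadditive D] [HasZeroObject D] [HasShift D ℤ]
    [∀ n : ℤ, (shiftFunctor D n).Additive] [Pretriangulated D] (P : ObjectProperty D) :
    Set (P.FullSubcategory →₀ R) :=
  {r | ∃ T ∈ distTriang D, ∃ (h₁ : P T.obj₁) (h₂ : P T.obj₂) (h₃ : P T.obj₃),
    r = .single ⟨T.obj₂, h₂⟩ 1 - .single ⟨T.obj₁, h₁⟩ 1 - .single ⟨T.obj₃, h₃⟩ 1} ∪
  {r | ∃ (X : D) (h : P X) (h' : P (X⟦(1 : ℤ)⟧)), r = .single ⟨X⟦(1 : ℤ)⟧, h'⟩ 1 + .single ⟨X, h⟩ 1}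

/-- The relations `[X] = [Y] + [Z]` for `X ≅ Y ⊕ Z`, where `X`, `Y`, `Z` are objects of the full
subcategory `P` of an additive category. -/
def directSumRelations {C : Type*} [Category* C] [Preadditive C] [HasBinaryBiproducts C]
    (P : ObjectProperty C) : Set (P.FullSubcategory →₀ R) :=
  {r | ∃ X Y Z : P.FullSubcategory, Nonempty (X.obj ≅ Y.obj ⊞ Z.obj) ∧
    r = .single X 1 - .single Y 1 - .single Z 1}

/-- The relations `[X{n}] = q ^ n [X]` over `ℤ[q, q⁻¹]`, for a family of functors
`S n : X ↦ X{n}`; they are imposed for all objects of `P` isomorphic to `X{n}`. -/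
def shiftRelations {C : Type*} [Category* C] (P : ObjectProperty C) (S : ℤ → C ⥤ C) :
    Set (P.FullSubcategory →₀ ℤ[T;T⁻¹]) :=
  {r | ∃ (n : ℤ) (X Y : P.FullSubcategory), Nonempty (Y.obj ≅ (S n).obj X.obj) ∧
    r = .single Y 1 - .single X (LaurentPolynomial.T n)}

end Relations

/-! ### The ungraded case: an ordinary ring `A`

A dg module over `A`, placed in cohomological degree `0` with zero differential, is a family of
`A`-modules `M^i` with `A`-linear differentials `d : M^i ⟶ M^{i+1}`, `d ∘ d = 0`, that is, a cochain
complex of `A`-modules.  So the derived category of dg modules over `A` is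
`DerivedCategory (ModuleCat A)`, the localization of `CochainComplex (ModuleCat A) ℤ` at the
quasi-isomorphisms. -/

section Ungraded

variable (A : Type u) [Ring A]

/-- Finitely generated projective left `A`-modules. -/
def fgProjective : ObjectProperty (ModuleCat.{u} A) := fun M =>
  Module.Finite A M ∧ Module.Projective A M

/-- The classical `K₀` of `A`. -/
abbrev ClassicalK0 : Type (u + 1) :=
  ((fgProjective A).FullSubcategory →₀ ℤ) ⧸
    Submodule.span ℤ (directSumRelations ℤ (fgProjective A))

/-- The class `[P]` of a finitely generated projective module. -/
noncomputable def ClassicalK0.mk (P : (fgProjective A).FullSubcategory) : ClassicalK0 A :=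
  Submodule.Quotient.mk (.single P 1)

variable [HasDerivedCategory.{w} (ModuleCat.{u} A)]

/-- Compact objects of the derived category of dg modules over `A`. -/
abbrev compactDg : ObjectProperty (DerivedCategory (ModuleCat.{u} A)) := isCompactObject.{u} _

/-- The Grothendieck group of the triangulated category of compact objects of the derived category
of dg modules over `A`. -/
abbrev DgK0 : Type (u + 1) :=
  ((compactDg A).FullSubcategory →₀ ℤ) ⧸ Submodule.span ℤ (triangleRelations ℤ (compactDg A))

/-- The class `[M]` of a compact object. -/
noncomputable def DgK0.mk (M : (compactDg A).FullSubcategory) : DgK0 A :=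
  Submodule.Quotient.mk (.single M 1)

end Ungraded

/-! ### The graded case: a `ℤ`-graded ring `A`

In the same way, a graded dg module over the graded ring `A`, placed in cohomological degree `0`
with zero differential, is a cochain complex of graded `A`-modules (with differentials preserving
the `q`-grading), and the derived category of graded dg modules is `DerivedCategory (GrMod 𝒜)`. -/

section Graded

variable {A : Type u} [Ring A] (𝒜 : ℤ → AddSubgroup A)

/-- Finitely generated graded projective left `A`-modules: finitely generated as `A`-modules, and
projective as `A`-modules. -/
def grFgProjective : ObjectProperty (GrMod 𝒜) := fun M =>
  Module.Finite A M.carrier ∧ Module.Projective A M.carrier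

/-- The classical `K₀` of the graded ring `A`, a `ℤ[q, q⁻¹]`-module. -/
abbrev GrClassicalK0 : Type (u + 1) :=
  ((grFgProjective 𝒜).FullSubcategory →₀ ℤ[T;T⁻¹]) ⧸
    Submodule.span ℤ[T;T⁻¹] (directSumRelations ℤ[T;T⁻¹] (grFgProjective 𝒜) ∪
      shiftRelations (grFgProjective 𝒜) (GrMod.shift 𝒜))

/-- The class `[P]` of a finitely generated graded projective module. -/
noncomputable def GrClassicalK0.mk (P : (grFgProjective 𝒜).FullSubcategory) : GrClassicalK0 𝒜 :=
  Submodule.Quotient.mk (.single P 1)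

variable [HasDerivedCategory.{w} (GrMod 𝒜)]

/-- Compact objects of the derived category of graded dg modules over `A`. -/
abbrev compactGrDg : ObjectProperty (DerivedCategory (GrMod 𝒜)) := isCompactObject.{u} _

/-- The Grothendieck group of the triangulated category of compact objects of the derived category
of graded dg modules over `A`, a `ℤ[q, q⁻¹]`-module with `q` acting by the shift of the
`q`-grading. -/
abbrev GrDgK0 : Type (u + 1) :=
  ((compactGrDg 𝒜).FullSubcategory →₀ ℤ[T;T⁻¹]) ⧸
    Submodule.span ℤ[T;T⁻¹] (triangleRelations ℤ[T;T⁻¹] (compactGrDg 𝒜) ∪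
      shiftRelations (compactGrDg 𝒜) fun n => (GrMod.shift 𝒜 n).mapDerivedCategory)

/-- The class `[M]` of a compact object. -/
noncomputable def GrDgK0.mk (M : (compactGrDg 𝒜).FullSubcategory) : GrDgK0 𝒜 :=
  Submodule.Quotient.mk (.single M 1)

end Graded

/-! ### Resolutions by a silting subcategory of a triangulated category -/

/-! The inverse of `[P] ↦ [P]` is the Euler characteristic: a compact object is, up to shift,
finitely resolved by finitely generated projectives, and the alternating sum of the terms is
independent of the resolution. The argument avoids perfect complexes and works inside the
triangulated category.

Call the objects `P[0]` silting objects. They satisfy `Hom(P[0], P'[0][k]) = 0` for `k > 0`. A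
resolution of length `n + 1` of `M` is a triangle `N ⟶ X ⟶ M ⟶ N⟦1⟧` with `X` silting and a
resolution of length `n` of `N`. By the vanishing, maps from silting objects to `M` lift to `X`, as
they do along a surjection in module theory. Hence the classical arguments apply, with octahedra in
place of diagram chases: Schanuel's lemma makes the Euler characteristic unique (`Res.unique`), the
horseshoe lemma makes it additive on triangles (`Res.of_distTriang`), and a Schanuel argument shows
that direct summands inherit resolutions (`Res.exists_of_biprod`).

That every compact `M` has such a resolution after a shift comes from the telescope argument.
Attaching cells to kill all maps from shifted generators, again and again, gives a tower starting at
`M` with zero homotopy colimit. Compactness makes `M` die at a finite stage, so the identity of `M`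
factors through a finite cell object (`IsCompactGenerating.exists_retract`). Finite cell objects are
resolved by the horseshoe lemma, and retracts of them by the summand lemma.

Both cases are instances of one statement about an abelian category with compact projective
generators, `exists_linearEquiv_of_relations`. It needs the localization functor to preserve
coproducts (`nonempty_isColimit_Q`). In the graded case the relations `[M{n}] = q^n[M]` are
respected because the grading shift is a triangulated functor preserving the silting objects
(`IsRes.map`). -/

namespace CategoryTheory.Pretriangulated

open Triangulated ZeroObject

variable {D : Type*} [Category* D] [Preadditive D] [HasZeroObject D] [HasShift D ℤ]
  [∀ n : ℤ, (shiftFunctor D n).Additive] [Pretriangulated D]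

/-! ### Manipulation of triangles, homotopy pullbacks and Schanuel's lemma -/

section Triangles

variable {X Y Z : D} {f : X ⟶ Y} {g : Y ⟶ Z} {h : Z ⟶ X⟦(1 : ℤ)⟧}

theorem distTriang_of_iso (hT : Triangle.mk f g h ∈ distTriang D) {X' Y' Z' : D} {f' : X' ⟶ Y'}
    {g' : Y' ⟶ Z'} {h' : Z' ⟶ X'⟦(1 : ℤ)⟧} (a : X' ≅ X) (b : Y' ≅ Y) (c : Z' ≅ Z)
    (h₁ : f' ≫ b.hom = a.hom ≫ f) (h₂ : g' ≫ c.hom = b.hom ≫ g)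
    (h₃ : h' ≫ a.hom⟦1⟧' = c.hom ≫ h) : Triangle.mk f' g' h' ∈ distTriang D :=
  isomorphic_distinguished _ hT _ (Triangle.isoMk _ _ a b c h₁ h₂ h₃)

theorem distTriang_congr₃ (hT : Triangle.mk f g h ∈ distTriang D) {Z' : D} (e : Z ≅ Z') :
    Triangle.mk f (g ≫ e.hom) (e.inv ≫ h) ∈ distTriang D :=
  distTriang_of_iso hT (Iso.refl _) (Iso.refl _) e.symm (by simp) (by simp) (by simp)

theorem distTriang_congr₂ (hT : Triangle.mk f g h ∈ distTriang D) {Y' : D} (e : Y ≅ Y') :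
    Triangle.mk (f ≫ e.hom) (e.inv ≫ g) h ∈ distTriang D :=
  distTriang_of_iso hT (Iso.refl _) e.symm (Iso.refl _) (by simp) (by simp) (by simp)

theorem distTriang_congr₁ (hT : Triangle.mk f g h ∈ distTriang D) {X' : D} (e : X ≅ X') :
    Triangle.mk (e.inv ≫ f) g (h ≫ e.hom⟦1⟧') ∈ distTriang D :=
  distTriang_of_iso hT e.symm (Iso.refl _) (Iso.refl _) (by simp) (by simp)
    (by simp [← Functor.map_comp])

theorem distTriang_rotate (hT : Triangle.mk f g h ∈ distTriang D) :
    Triangle.mk g h (-f⟦(1 : ℤ)⟧') ∈ distTriang D :=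
  rot_of_distTriang _ hT

theorem distTriang_comp₁₂ (hT : Triangle.mk f g h ∈ distTriang D) : f ≫ g = 0 :=
  comp_distTriang_mor_zero₁₂ _ hT

theorem distTriang_comp₂₃ (hT : Triangle.mk f g h ∈ distTriang D) : g ≫ h = 0 :=
  comp_distTriang_mor_zero₂₃ _ hT

theorem distTriang_comp₃₁ (hT : Triangle.mk f g h ∈ distTriang D) : h ≫ f⟦(1 : ℤ)⟧' = 0 :=
  comp_distTriang_mor_zero₃₁ _ hT

theorem exists_lift₁ (hT : Triangle.mk f g h ∈ distTriang D) {W : D} (k : W ⟶ Y)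
    (hk : k ≫ g = 0) : ∃ l : W ⟶ X, k = l ≫ f :=
  Triangle.coyoneda_exact₂ _ hT k hk

theorem exists_lift₂ (hT : Triangle.mk f g h ∈ distTriang D) {W : D} (k : W ⟶ Z)
    (hk : k ≫ h = 0) : ∃ l : W ⟶ Y, k = l ≫ g :=
  Triangle.coyoneda_exact₂ _ (rot_of_distTriang _ hT) k hk

theorem exists_desc₂ (hT : Triangle.mk f g h ∈ distTriang D) {W : D} (k : Y ⟶ W)
    (hk : f ≫ k = 0) : ∃ l : Z ⟶ W, k = g ≫ l :=
  Triangle.yoneda_exact₂ _ hT k hk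

theorem exists_lift₂_shift (hT : Triangle.mk f g h ∈ distTriang D) (n : ℤ) {W : D} (k : W ⟶ Z⟦n⟧)
    (hk : k ≫ h⟦n⟧' = 0) : ∃ l : W ⟶ Y⟦n⟧, k = l ≫ g⟦n⟧' := by
  -- Shifting a triangle by `n` multiplies its maps by `(-1)^n`; the sign is a unit and is absorbed
  -- into the lift.
  obtain ⟨(l : W ⟶ Y⟦n⟧), hl⟩ := Triangle.coyoneda_exact₃ _ (Triangle.shift_distinguished _ hT n) k (by
    change k ≫ (n.negOnePow • h⟦n⟧' ≫ (shiftFunctorComm D 1 n).hom.app X : _ ⟶ _) = 0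
    rw [Linear.comp_units_smul, reassoc_of% hk, zero_comp, smul_zero])
  refine ⟨n.negOnePow • l, hl.trans ?_⟩
  change l ≫ (n.negOnePow • g⟦n⟧' : _ ⟶ _) = (n.negOnePow • l) ≫ g⟦n⟧'
  rw [Linear.comp_units_smul, Linear.units_smul_comp]

/-- A distinguished triangle `X⟦1⟧ ⟶ Y⟦1⟧ ⟶ Z⟦1⟧⟦1⟧` comes from a triangle `Z ⟶ X ⟶ Y`. -/
theorem exists_distTriang_of_shift {u : X⟦(1 : ℤ)⟧ ⟶ Y⟦(1 : ℤ)⟧}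
    {v : Y⟦(1 : ℤ)⟧ ⟶ Z⟦(1 : ℤ)⟧⟦(1 : ℤ)⟧} {w : Z⟦(1 : ℤ)⟧⟦(1 : ℤ)⟧ ⟶ X⟦(1 : ℤ)⟧⟦(1 : ℤ)⟧}
    (hT : Triangle.mk u v w ∈ distTriang D) :
    ∃ (f : Z ⟶ X) (g : X ⟶ Y) (h : Y ⟶ Z⟦(1 : ℤ)⟧), Triangle.mk f g h ∈ distTriang D := by
  obtain ⟨u, rfl⟩ := (shiftFunctor D (1 : ℤ)).map_surjective u
  -- The sign of `-u` cancels the one that rotation puts on the shifted map, so the fourfold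
  -- rotation starts with `u⟦1⟧'`.
  obtain ⟨Z', f, h, hT'⟩ := distinguished_cocone_triangle₁ (-u)
  have h₃ := distTriang_rotate (distTriang_rotate (distTriang_rotate (distTriang_rotate hT')))
  let e := isoTriangleOfIso₁₂ _ _ h₃ hT (Iso.refl _) (Iso.refl _) (by
    change (-(-u)⟦(1 : ℤ)⟧') ≫ 𝟙 _ = 𝟙 _ ≫ u⟦(1 : ℤ)⟧'
    simp)
  let e' : Z'⟦(1 : ℤ)⟧⟦(1 : ℤ)⟧ ≅ Z⟦(1 : ℤ)⟧⟦(1 : ℤ)⟧ := Triangle.π₃.mapIso e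
  exact ⟨_, _, _, distTriang_congr₁ hT'
    ((shiftFunctor D (1 : ℤ)).preimageIso ((shiftFunctor D (1 : ℤ)).preimageIso e'))⟩

theorem nonempty_iso_biprod_of_distTriang (hT : Triangle.mk f g h ∈ distTriang D) (hh : h = 0) :
    Nonempty (Y ≅ X ⊞ Z) :=
  ⟨(exists_iso_binaryBiproduct_of_distTriang _ hT hh).choose⟩

end Triangles

/-- The direct sum of a distinguished triangle and `0 ⟶ Q ⟶ Q ⟶ 0`. -/
theorem exists_distTriang_biprod [IsTriangulated D] {N X M : D} {f : N ⟶ X} {g : X ⟶ M}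
    {h : M ⟶ N⟦(1 : ℤ)⟧} (hT : Triangle.mk f g h ∈ distTriang D) (Q : D) :
    ∃ (f' : N ⟶ X ⊞ Q) (g' : X ⊞ Q ⟶ M ⊞ Q) (h' : M ⊞ Q ⟶ N⟦(1 : ℤ)⟧),
      Triangle.mk f' g' h' ∈ distTriang D := by
  obtain ⟨Z, v, w, hZ⟩ := distinguished_cocone_triangle (f ≫ (biprod.inl : X ⟶ X ⊞ Q))
  -- The cone `Z` of `N ⟶ X ⊞ Q` is an extension of `Q` by `M` whose connecting map factors through
  -- `Q ⟶ X⟦1⟧`, which is zero.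
  let o := someOctahedron rfl hT (binaryBiproductTriangle_distinguished X Q) hZ
  obtain ⟨e⟩ := nonempty_iso_biprod_of_distTriang o.mem zero_comp
  exact ⟨_, _, _, distTriang_congr₃ hZ e⟩

/-- A homotopy pullback of `X ⟶ M` and `X' ⟶ M` splits if the second map lifts to `X`. -/
theorem nonempty_iso_biprod_of_lift [IsTriangulated D] {N X M X' E : D} {f : N ⟶ X} {p : X ⟶ M}
    {h : M ⟶ N⟦(1 : ℤ)⟧} (hT : Triangle.mk f p h ∈ distTriang D) (s : X' ⟶ X)
    {i : E ⟶ X ⊞ X'} {k : M ⟶ E⟦(1 : ℤ)⟧}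
    (hE : Triangle.mk i (biprod.desc p (s ≫ p)) k ∈ distTriang D) : Nonempty (E ≅ N ⊞ X') := by
  -- The shear `(x', x) ↦ (x - s x', x')` turns `(p, s ≫ p)` into `p` on the summand `X` and zero on
  -- `X'`, so the fiber splits off `X'`.
  let e : X' ⊞ X ≅ X ⊞ X' :=
    { hom := biprod.lift (biprod.snd - biprod.fst ≫ s) biprod.fst
      inv := biprod.lift biprod.snd (biprod.fst + biprod.snd ≫ s)
      hom_inv_id := by ext <;> simp
      inv_hom_id := by ext <;> simp }
  have h₁ := distTriang_congr₂ (binaryBiproductTriangle_distinguished X' X) e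
  let o := someOctahedron' (u₁₃ := biprod.desc p (s ≫ p)) (by ext <;> simp [e]) h₁ hT hE
  obtain ⟨e'⟩ := nonempty_iso_biprod_of_distTriang o.mem comp_zero
  exact ⟨e' ≪≫ biprod.braiding _ _⟩

/-- Schanuel's lemma. -/
theorem schanuel [IsTriangulated D] {N X M N' X' : D} {f : N ⟶ X} {g : X ⟶ M}
    {h : M ⟶ N⟦(1 : ℤ)⟧} {f' : N' ⟶ X'} {g' : X' ⟶ M} {h' : M ⟶ N'⟦(1 : ℤ)⟧}
    (hT : Triangle.mk f g h ∈ distTriang D) (hT' : Triangle.mk f' g' h' ∈ distTriang D)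
    {s : X' ⟶ X} (hs : g' = s ≫ g) {s' : X ⟶ X'} (hs' : g = s' ≫ g') :
    Nonempty (N ⊞ X' ≅ N' ⊞ X) := by
  -- `E` is the homotopy pullback of `X` and `X'` over `M`; each of the two lifts splits it in one
  -- way.
  obtain ⟨E, i, k, hE⟩ := distinguished_cocone_triangle₁ (biprod.desc g g')
  obtain ⟨e⟩ := nonempty_iso_biprod_of_lift hT s (by rw [← hs]; exact hE)
  have hE' := distTriang_congr₂ hE (biprod.braiding X X')
  rw [show (biprod.braiding X X').inv ≫ biprod.desc g g' = biprod.desc g' (s' ≫ g') by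
    rw [← hs']; ext <;> simp] at hE'
  obtain ⟨e'⟩ := nonempty_iso_biprod_of_lift hT' s' hE'
  exact ⟨e.symm ≪≫ e'⟩

/-- A property `P` of objects with vanishing positive self-extensions, closed under finite direct
sums and retracts, and an invariant `cl` of these objects which is additive on direct sums. -/
structure SiltingInvariant (D : Type*) [Category* D] [Preadditive D] [HasZeroObject D]
    [HasShift D ℤ] [∀ n : ℤ, (shiftFunctor D n).Additive] [Pretriangulated D]
    (G : Type*) [AddCommGroup G] where
  P : ObjectProperty D
  cl : D → G
  zero : P (0 : D)
  biprod : ∀ {X Y : D}, P X → P Y → P (X ⊞ Y)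
  retract : ∀ {X Y : D}, Retract X Y → P Y → P X
  cl_iso : ∀ {X Y : D}, (X ≅ Y) → P X → cl X = cl Y
  cl_biprod : ∀ {X Y : D}, P X → P Y → cl (X ⊞ Y) = cl X + cl Y
  hom_eq_zero : ∀ {X Y : D}, P X → P Y → ∀ k : ℤ, 0 < k → ∀ f : X ⟶ Y⟦k⟧, f = 0

/-! ### Finite resolutions and their Euler characteristics -/

namespace SiltingInvariant

variable {G : Type*} [AddCommGroup G] (S : SiltingInvariant D G)

theorem iso {X Y : D} (e : X ≅ Y) (hX : S.P X) : S.P Y := S.retract e.symm.retract hX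

theorem cl_zero : S.cl 0 = 0 := by
  have h := S.cl_biprod S.zero S.zero
  have e : (0 : D) ≅ 0 ⊞ 0 := (isZero_zero D).iso
    ((IsZero.iff_id_eq_zero _).2 (by ext))
  rw [← S.cl_iso e S.zero] at h
  simpa using h

/-- `S.Res n M x`: the object `M` has a resolution of length `n` by objects in `S.P`, with
alternating sum of classes `x`. -/
inductive Res : ℕ → D → G → Prop
  | zero {M : D} (hM : S.P M) : Res 0 M (S.cl M)
  | succ {n : ℕ} {N X M : D} {f : N ⟶ X} {g : X ⟶ M} {h : M ⟶ N⟦(1 : ℤ)⟧} {y : G}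
      (hX : S.P X) (hT : Triangle.mk f g h ∈ distTriang D) (hN : Res n N y) :
      Res (n + 1) M (S.cl X - y)

namespace Res

variable {S}

theorem exists_of_zero {M : D} {x : G} (h : S.Res 0 M x) : S.P M ∧ x = S.cl M := by
  cases h with
  | zero hM => exact ⟨hM, rfl⟩

theorem exists_of_succ {n : ℕ} {M : D} {x : G} (h : S.Res (n + 1) M x) :
    ∃ (N X : D) (f : N ⟶ X) (g : X ⟶ M) (h : M ⟶ N⟦(1 : ℤ)⟧) (y : G), S.P X ∧
      Triangle.mk f g h ∈ distTriang D ∧ S.Res n N y ∧ x = S.cl X - y := by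
  cases h with
  | succ hX hT hN => exact ⟨_, _, _, _, _, _, hX, hT, hN, rfl⟩

/-- Extends the vanishing of positive extensions along a resolution; for `k = 1` it is the lifting
property that Schanuel's lemma and the horseshoe lemma need. -/
theorem hom_eq_zero {n : ℕ} {M : D} {x : G} (h : S.Res n M x) {X : D} (hX : S.P X) (k : ℤ)
    (hk : 0 < k) (f : X ⟶ M⟦k⟧) : f = 0 := by
  induction h generalizing k with
  | zero hM => exact S.hom_eq_zero hX hM k hk f
  | @succ n N Y M a b c y hY hT hN ih =>
    -- The target is `N⟦1⟧⟦k⟧ ≅ N⟦1 + k⟧`, so the induction hypothesis is used one degree higher.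
    have h1 : f ≫ c⟦k⟧' = 0 := by
      rw [← cancel_mono ((shiftFunctorAdd' D 1 k (1 + k) rfl).inv.app N), zero_comp]
      exact ih (1 + k) (by omega) _
    obtain ⟨g, hg⟩ := exists_lift₂_shift hT k f h1
    rw [hg, S.hom_eq_zero hX hY k hk g, zero_comp]

theorem of_iso {n : ℕ} {M M' : D} {x : G} (h : S.Res n M x) (e : M ≅ M') : S.Res n M' x := by
  cases h with
  | zero hM =>
    rw [S.cl_iso e hM]
    exact .zero (S.iso e hM)
  | succ hX hT hN => exact .succ hX (distTriang_congr₃ hT e) hN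

theorem biprod [IsTriangulated D] {n : ℕ} {M Q : D} {x : G} (h : S.Res n M x) (hQ : S.P Q) :
    S.Res n (M ⊞ Q) (x + S.cl Q) := by
  cases h with
  | zero hM =>
    rw [← S.cl_biprod hM hQ]
    exact .zero (S.biprod hM hQ)
  | @succ n N X _ _ _ _ y hX hT hN =>
    obtain ⟨_, _, _, hT'⟩ := exists_distTriang_biprod hT Q
    rw [show S.cl X - y + S.cl Q = S.cl (X ⊞ Q) - y by rw [S.cl_biprod hX hQ]; abel]
    exact .succ (S.biprod hX hQ) hT' hN

/-- Schanuel gives `N ⊞ X' ≅ N' ⊞ X`. Both sides have resolutions of length `n`, with Euler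
characteristics `y + [X']` and `y' + [X]`, which agree by induction. -/
theorem unique [IsTriangulated D] {n : ℕ} {M : D} {x x' : G} (h : S.Res n M x)
    (h' : S.Res n M x') : x = x' := by
  induction n generalizing M x x' with
  | zero => rw [h.exists_of_zero.2, h'.exists_of_zero.2]
  | succ n ih =>
    obtain ⟨N, X, _, _, _, y, hX, hT, hN, rfl⟩ := h.exists_of_succ
    obtain ⟨N', X', _, _, _, y', hX', hT', hN', rfl⟩ := h'.exists_of_succ
    obtain ⟨s, hs⟩ := exists_lift₂ hT _ (hN.hom_eq_zero hX' 1 one_pos _)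
    obtain ⟨s', hs'⟩ := exists_lift₂ hT' _ (hN'.hom_eq_zero hX 1 one_pos _)
    obtain ⟨e⟩ := schanuel hT hT' hs hs'
    have := ih ((hN.biprod hX').of_iso e) (hN'.biprod hX)
    rw [sub_eq_sub_iff_add_eq_add, add_comm, ← this, add_comm]

theorem succ_length {n : ℕ} {M : D} {x : G} (h : S.Res n M x) : S.Res (n + 1) M x := by
  induction h with
  | @zero M hM =>
    rw [show S.cl M = S.cl M - S.cl 0 by rw [S.cl_zero, sub_zero]]
    exact .succ hM (contractible_distinguished₁ M) (.zero S.zero)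
  | succ hX hT hN ih => exact .succ hX hT ih

theorem mono {n m : ℕ} {M : D} {x : G} (h : S.Res n M x) (hnm : n ≤ m) : S.Res m M x := by
  induction hnm with
  | refl => exact h
  | step _ ih => exact ih.succ_length

theorem shift {n : ℕ} {M : D} {x : G} (h : S.Res n M x) : S.Res (n + 1) (M⟦(1 : ℤ)⟧) (-x) := by
  rw [show -x = S.cl 0 - x by rw [S.cl_zero, zero_sub]]
  exact .succ S.zero (contractible_distinguished₂ M) h

/-- The horseshoe lemma. -/
theorem of_distTriang [IsTriangulated D] {n : ℕ} {M₁ M₂ M₃ : D} {x₁ x₃ : G} (h₁ : S.Res n M₁ x₁)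
    (h₃ : S.Res n M₃ x₃) {f : M₁ ⟶ M₂} {g : M₂ ⟶ M₃} {h : M₃ ⟶ M₁⟦(1 : ℤ)⟧}
    (hT : Triangle.mk f g h ∈ distTriang D) : S.Res n M₂ (x₁ + x₃) := by
  induction n generalizing M₁ M₂ M₃ x₁ x₃ with
  | zero =>
    obtain ⟨p₁, rfl⟩ := h₁.exists_of_zero
    obtain ⟨p₃, rfl⟩ := h₃.exists_of_zero
    obtain ⟨e⟩ := nonempty_iso_biprod_of_distTriang hT (S.hom_eq_zero p₃ p₁ 1 one_pos _)
    rw [← S.cl_biprod p₁ p₃]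
    exact Res.of_iso (.zero (S.biprod p₁ p₃)) e.symm
  | succ n ih =>
    have h₁' := h₁
    obtain ⟨N₁, X₁, a₁, p₁, b₁, y₁, hX₁, hT₁, hN₁, rfl⟩ := h₁.exists_of_succ
    obtain ⟨N₃, X₃, a₃, p₃, b₃, y₃, hX₃, hT₃, hN₃, rfl⟩ := h₃.exists_of_succ
    obtain ⟨s, hs⟩ := exists_lift₂ hT p₃ (h₁'.hom_eq_zero hX₃ 1 one_pos _)
    -- `M₂` modulo `X₁`, and its quotient by `X₃`
    obtain ⟨C, c, d, hC⟩ := distinguished_cocone_triangle (p₁ ≫ f)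
    let o₁ := someOctahedron rfl (distTriang_rotate hT₁) hT hC
    obtain ⟨N₂, u, v, hN₂⟩ := distinguished_cocone_triangle₁ (biprod.desc (p₁ ≫ f) s)
    let o₂ := someOctahedron (u₁₃ := p₁ ≫ f) (by simp)
      (binaryBiproductTriangle_distinguished X₁ X₃) (distTriang_rotate hN₂) hC
    -- `C` sits in triangles `N₁⟦1⟧ ⟶ C ⟶ M₃` and `X₃ ⟶ C ⟶ N₂⟦1⟧`. The composite `X₃ ⟶ C ⟶ M₃` is
    -- the given map `p₃` since `s` lifts it, and the octahedron on this composite yields `N₂⟦1⟧ ⟶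
    -- N₃⟦1⟧ ⟶ N₁⟦1⟧⟦1⟧`, to be desuspended.
    have hr : o₂.m₁ ≫ o₁.m₃ = p₃ := by
      have e₁ := o₂.comm₁
      have e₂ := o₁.comm₃
      rw [← cancel_epi (biprod.snd : X₁ ⊞ X₃ ⟶ X₃), reassoc_of% e₁, e₂]
      ext
      · simp [distTriang_comp₁₂ hT]
      · simp [hs]
    let o₃ := someOctahedron hr o₂.mem (distTriang_rotate o₁.mem) (distTriang_rotate hT₃)
    obtain ⟨_, _, _, hN⟩ := exists_distTriang_of_shift o₃.mem
    rw [show S.cl X₁ - y₁ + (S.cl X₃ - y₃) = S.cl (X₁ ⊞ X₃) - (y₁ + y₃) by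
      rw [S.cl_biprod hX₁ hX₃]; abel]
    exact .succ (S.biprod hX₁ hX₃) hN₂ (ih hN₁ hN₃ hN)

/-- Resolutions of a direct sum give resolutions of the summands. -/
theorem exists_of_biprod [IsTriangulated D] {n : ℕ} {M M' : D} {x : G} (h : S.Res n (M ⊞ M') x) :
    ∃ y, S.Res n M y := by
  induction n generalizing M M' x with
  | zero =>
    exact ⟨_, .zero (S.retract ⟨biprod.inl, biprod.fst, by simp⟩ h.exists_of_zero.1)⟩
  | succ n ih =>
    obtain ⟨N, X, a, p, b, y, hX, hT, hN, rfl⟩ := h.exists_of_succ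
    obtain ⟨N₁, a₁, b₁, h₁⟩ := distinguished_cocone_triangle₁ (p ≫ biprod.fst)
    obtain ⟨N₂, a₂, b₂, h₂⟩ := distinguished_cocone_triangle₁ (p ≫ biprod.snd)
    have hM := distTriang_congr₂ (binaryBiproductTriangle_distinguished M' M)
      (biprod.braiding M' M)
    rw [show (biprod.braiding M' M).inv ≫ biprod.snd = biprod.fst by simp] at hM
    -- The fiber `N₁` of `X ⟶ M` also sits in a triangle `N ⟶ N₁ ⟶ M'`. Comparing it with `N₂ ⟶ X ⟶
    -- M'` by Schanuel's lemma gives `N ⊞ X ≅ N₂ ⊞ N₁`, so `N₁` is a summand of an object with a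
    -- resolution of length `n`.
    let o := someOctahedron' rfl hT hM h₁
    have ho : o.m₃ = a₁ ≫ p ≫ biprod.snd := by
      have := o.comm₄
      rw [← Category.assoc, ← this]
      simp
    obtain ⟨s, hs⟩ := exists_lift₂ o.mem (p ≫ biprod.snd) (hN.hom_eq_zero hX 1 one_pos _)
    obtain ⟨e⟩ := schanuel o.mem h₂ hs ho
    obtain ⟨y₁, hy₁⟩ := ih (((hN.biprod hX).of_iso e).of_iso (biprod.braiding _ _))
    exact ⟨_, .succ hX h₁ hy₁⟩

theorem exists_of_retract [IsTriangulated D] {n : ℕ} {M M' : D} {x : G} (h : S.Res n M' x)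
    (r : Retract M M') : ∃ y, S.Res n M y := by
  obtain ⟨Z, f, g, hT⟩ := distinguished_cocone_triangle r.i
  -- The first map of the triangle is a split monomorphism, so the connecting map vanishes and `M`
  -- is a direct summand of `M'`.
  have hg : g = 0 := by
    rw [← Category.comp_id g, ← (shiftFunctor D (1 : ℤ)).map_id, ← r.retract, Functor.map_comp,
      reassoc_of% distTriang_comp₃₁ hT, zero_comp]
  obtain ⟨e⟩ := nonempty_iso_biprod_of_distTriang hT hg
  exact (h.of_iso e).exists_of_biprod

theorem shift_nat [IsTriangulated D] {n : ℕ} {M : D} {x : G} (h : S.Res n M x) (k : ℕ) :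
    S.Res (n + k) (M⟦(k : ℤ)⟧) ((-1 : ℤ) ^ k • x) := by
  induction k with
  | zero => simpa using h.of_iso ((shiftFunctorZero' D (0 : ℤ) rfl).symm.app M)
  | succ k ih =>
    have := ih.shift.of_iso ((shiftFunctorAdd' D (k : ℤ) 1 ((k + 1 : ℕ) : ℤ) (by simp)).symm.app M)
    rwa [pow_succ, mul_neg_one, neg_smul]

/-- Resolutions are preserved by triangulated functors preserving the silting subcategory. -/
theorem map {n : ℕ} {M : D} {x : G} (h : S.Res n M x) (F : D ⥤ D) [F.CommShift ℤ]
    [F.IsTriangulated] (ψ : G →+ G) (hP : ∀ X, S.P X → S.P (F.obj X))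
    (hψ : ∀ X, S.P X → S.cl (F.obj X) = ψ (S.cl X)) : S.Res n (F.obj M) (ψ x) := by
  induction h with
  | zero hM =>
    rw [← hψ _ hM]
    exact .zero (hP _ hM)
  | succ hX hT hN ih =>
    rw [map_sub, ← hψ _ hX]
    exact .succ (hP _ hX) (F.map_distinguished _ hT) ih

end Res

/-- `S.IsRes M x`: some shift of `M` has a finite resolution by objects in `S.P`, and `x` is the
Euler characteristic of `M`. -/
def IsRes (M : D) (x : G) : Prop :=
  ∃ k n : ℕ, S.Res n (M⟦(k : ℤ)⟧) ((-1 : ℤ) ^ k • x)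

namespace IsRes

variable {S}

/-- Both the shift and the length may be enlarged, so finitely many resolutions can always be
brought to a common shift and a common length. -/
theorem exists_forall_res [IsTriangulated D] {M : D} {x : G} (h : S.IsRes M x) :
    ∃ a : ℕ, ∀ k, a ≤ k → ∃ b : ℕ, ∀ n, b ≤ n → S.Res n (M⟦(k : ℤ)⟧) ((-1 : ℤ) ^ k • x) := by
  obtain ⟨a, n, h⟩ := h
  refine ⟨a, fun k hk => ?_⟩
  obtain ⟨l, rfl⟩ := Nat.exists_eq_add_of_le hk
  have h' := (h.shift_nat l).of_iso
    ((shiftFunctorAdd' D (a : ℤ) l ((a + l : ℕ) : ℤ) (by simp)).symm.app M)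
  rw [smul_smul, ← pow_add, add_comm l] at h'
  exact ⟨_, fun m hm => h'.mono hm⟩

theorem unique [IsTriangulated D] {M : D} {x x' : G} (h : S.IsRes M x) (h' : S.IsRes M x') :
    x = x' := by
  obtain ⟨a, h⟩ := h.exists_forall_res
  obtain ⟨a', h'⟩ := h'.exists_forall_res
  obtain ⟨b, h⟩ := h (a + a') (by omega)
  obtain ⟨b', h'⟩ := h' (a + a') (by omega)
  have := (h (b + b') (by omega)).unique (h' (b + b') (by omega))
  rcases neg_one_pow_eq_or ℤ (a + a') with h | h <;> rw [h] at this <;> simpa using this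

theorem of_P {M : D} (hM : S.P M) : S.IsRes M (S.cl M) :=
  ⟨0, 0, by simpa using (Res.zero hM).of_iso ((shiftFunctorZero' D (0 : ℤ) rfl).symm.app M)⟩

theorem of_iso {M M' : D} {x : G} (h : S.IsRes M x) (e : M ≅ M') : S.IsRes M' x := by
  obtain ⟨k, n, h⟩ := h
  exact ⟨k, n, h.of_iso ((shiftFunctor D (k : ℤ)).mapIso e)⟩

theorem shift_one [IsTriangulated D] {M : D} {x : G} (h : S.IsRes M x) :
    S.IsRes (M⟦(1 : ℤ)⟧) (-x) := by
  obtain ⟨k, n, h⟩ := h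
  refine ⟨k, n + 1, ?_⟩
  rw [smul_neg]
  exact h.shift.of_iso ((shiftFunctorComm D (k : ℤ) 1).app M)

theorem shift_neg_one [IsTriangulated D] {M : D} {x : G} (h : S.IsRes M x) :
    S.IsRes (M⟦(-1 : ℤ)⟧) (-x) := by
  obtain ⟨k, n, h⟩ := h
  refine ⟨k + 1, n, ?_⟩
  rw [pow_succ, mul_neg_one, neg_smul, smul_neg, neg_neg]
  exact h.of_iso ((shiftFunctorAdd' D (-1) ((k + 1 : ℕ) : ℤ) (k : ℤ) (by simp)).app M)

theorem exists_shift [IsTriangulated D] {M : D} {x : G} (h : S.IsRes M x) (k : ℤ) :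
    ∃ y, S.IsRes (M⟦k⟧) y := by
  induction k with
  | zero => exact ⟨_, h.of_iso ((shiftFunctorZero D ℤ).symm.app M)⟩
  | succ k ih =>
    obtain ⟨y, hy⟩ := ih
    exact ⟨_, hy.shift_one.of_iso ((shiftFunctorAdd' D (k : ℤ) 1 _ rfl).symm.app M)⟩
  | pred k ih =>
    obtain ⟨y, hy⟩ := ih
    exact ⟨_, hy.shift_neg_one.of_iso ((shiftFunctorAdd' D (-k : ℤ) (-1) _ rfl).symm.app M)⟩

theorem of_distTriang [IsTriangulated D] {M₁ M₂ M₃ : D} {x₁ x₃ : G} (h₁ : S.IsRes M₁ x₁)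
    (h₃ : S.IsRes M₃ x₃) {f : M₁ ⟶ M₂} {g : M₂ ⟶ M₃} {h : M₃ ⟶ M₁⟦(1 : ℤ)⟧}
    (hT : Triangle.mk f g h ∈ distTriang D) : S.IsRes M₂ (x₁ + x₃) := by
  obtain ⟨a, h₁⟩ := h₁.exists_forall_res
  obtain ⟨a', h₃⟩ := h₃.exists_forall_res
  obtain ⟨b, h₁⟩ := h₁ (a + a') (by omega)
  obtain ⟨b', h₃⟩ := h₃ (a + a') (by omega)
  refine ⟨a + a', b + b', ?_⟩
  rw [smul_add]
  exact (h₁ (b + b') (by omega)).of_distTriang (h₃ (b + b') (by omega))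
    (Triangle.shift_distinguished _ hT _)

theorem exists_of_retract [IsTriangulated D] {M M' : D} {x : G} (h : S.IsRes M' x)
    (r : Retract M M') : ∃ y, S.IsRes M y := by
  obtain ⟨k, n, h⟩ := h
  obtain ⟨y, hy⟩ := h.exists_of_retract (r.map (shiftFunctor D (k : ℤ)))
  refine ⟨(-1 : ℤ) ^ k • y, k, n, ?_⟩
  rwa [smul_smul, ← mul_pow, neg_one_mul, neg_neg, one_pow, one_smul]

theorem map [IsTriangulated D] {M : D} {x : G} (h : S.IsRes M x) (F : D ⥤ D) [F.CommShift ℤ]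
    [F.IsTriangulated] (ψ : G →+ G) (hP : ∀ X, S.P X → S.P (F.obj X))
    (hψ : ∀ X, S.P X → S.cl (F.obj X) = ψ (S.cl X)) : S.IsRes (F.obj M) (ψ x) := by
  obtain ⟨k, n, h⟩ := h
  refine ⟨k, n, ?_⟩
  rw [← map_zsmul]
  exact (h.map F ψ hP hψ).of_iso ((F.commShiftIso (k : ℤ)).app M)

end IsRes

end SiltingInvariant
end CategoryTheory.Pretriangulated

/-! ### Compact objects -/

namespace CategoryTheory

section Preadditive

variable {D : Type*} [Category* D] [Preadditive D]

open Classical in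
/-- The projection of a coproduct onto one of the summands. -/
noncomputable def coprodProj {J : Type*} {N : J → D} {X : D} {i : ∀ j, N j ⟶ X}
    (h : IsColimit (Cofan.mk X i)) (j : J) : X ⟶ N j :=
  Cofan.IsColimit.desc h fun k => if e : k = j then eqToHom (by rw [e]) else 0

section

variable {J : Type*} {N : J → D} {X : D} {i : ∀ j, N j ⟶ X} (h : IsColimit (Cofan.mk X i))

@[simp]
theorem coprodProj_same (j : J) : i j ≫ coprodProj h j = 𝟙 _ := by
  refine (Cofan.IsColimit.fac h _ j).trans ?_
  simp

@[simp]
theorem coprodProj_same_assoc (j : J) {Z : D} (f : N j ⟶ Z) : i j ≫ coprodProj h j ≫ f = f := by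
  rw [← Category.assoc, coprodProj_same, Category.id_comp]

theorem coprodProj_ne {j k : J} (hjk : j ≠ k) : i j ≫ coprodProj h k = 0 := by
  refine (Cofan.IsColimit.fac h _ j).trans ?_
  simp [hjk]

theorem coprodProj_ne_assoc {j k : J} (hjk : j ≠ k) {Z : D} (f : N k ⟶ Z) :
    i j ≫ coprodProj h k ≫ f = 0 ≫ f := by
  rw [← Category.assoc, coprodProj_ne h hjk]

omit [Preadditive D] in
include h in
theorem coprod_hom_ext {Y : D} {f g : X ⟶ Y} (hfg : ∀ j, i j ≫ f = i j ≫ g) : f = g :=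
  Cofan.IsColimit.hom_ext h _ _ hfg

omit [Preadditive D] in
include h in
theorem exists_coprod_desc {Y : D} (f : ∀ j, N j ⟶ Y) : ∃ g : X ⟶ Y, ∀ j, i j ≫ g = f j :=
  ⟨Cofan.IsColimit.desc h f, Cofan.IsColimit.fac h f⟩

/-- The idempotent of a coproduct projecting onto a finite subsum. -/
noncomputable def coprodIdem (T : Finset J) : X ⟶ X := ∑ j ∈ T, coprodProj h j ≫ i j

theorem ι_coprodIdem_of_mem {T : Finset J} {j : J} (hj : j ∈ T) : i j ≫ coprodIdem h T = i j := by
  rw [coprodIdem, Preadditive.comp_sum, Finset.sum_eq_single_of_mem j hj]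
  · simp
  · intro k _ hk
    rw [coprodProj_ne_assoc h hk.symm, zero_comp]

theorem ι_coprodIdem_of_notMem {T : Finset J} {j : J} (hj : j ∉ T) :
    i j ≫ coprodIdem h T = 0 := by
  rw [coprodIdem, Preadditive.comp_sum]
  refine Finset.sum_eq_zero fun k hk => ?_
  rw [coprodProj_ne_assoc h (by rintro rfl; exact hj hk), zero_comp]

theorem coprodIdem_comp {T T' : Finset J} (hT : T ⊆ T') :
    coprodIdem h T ≫ coprodIdem h T' = coprodIdem h T := by
  conv_lhs => rw [coprodIdem, Preadditive.sum_comp]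
  conv_rhs => rw [coprodIdem]
  refine Finset.sum_congr rfl fun j hj => ?_
  rw [Category.assoc, ι_coprodIdem_of_mem h (hT hj)]

end

/-- Every morphism to a coproduct of a family indexed by a type in `Type t` is a finite sum of
morphisms to the summands. -/
def FinCompact (M : D) : Prop :=
  ∀ (J : Type t) (N : J → D) (X : D) (i : ∀ j, N j ⟶ X), IsColimit (Cofan.mk X i) →
    ∀ f : M ⟶ X, ∃ (T : Finset J) (g : ∀ j, M ⟶ N j), f = ∑ j ∈ T, g j ≫ i j

/-- Fixing `f` by the idempotent of a finite subsum is a closed equation, easier to carry through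
triangles than an explicit finite sum. -/
theorem FinCompact.exists_idem {M : D} (hM : FinCompact.{t} M) {J : Type t} {N : J → D} {X : D}
    {i : ∀ j, N j ⟶ X} (h : IsColimit (Cofan.mk X i)) (f : M ⟶ X) :
    ∃ T : Finset J, f ≫ coprodIdem h T = f := by
  obtain ⟨T, g, hf⟩ := hM J N X i h f
  refine ⟨T, ?_⟩
  conv_rhs => rw [hf]
  rw [hf, Preadditive.sum_comp]
  refine Finset.sum_congr rfl fun j hj => ?_
  rw [Category.assoc, ι_coprodIdem_of_mem h hj]

theorem finCompact_of_exists_idem {M : D} (hM : ∀ (J : Type t) (N : J → D) (X : D)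
    (i : ∀ j, N j ⟶ X) (h : IsColimit (Cofan.mk X i)) (f : M ⟶ X),
      ∃ T : Finset J, f ≫ coprodIdem h T = f) : FinCompact.{t} M := by
  intro J N X i h f
  obtain ⟨T, hT⟩ := hM J N X i h f
  refine ⟨T, fun j => f ≫ coprodProj h j, ?_⟩
  conv_lhs => rw [← hT]
  simp [coprodIdem, Preadditive.comp_sum]

theorem finCompact_of_retract {M M' : D} (r : Retract M M') (hM : FinCompact.{t} M') :
    FinCompact.{t} M := by
  intro J N X i h f
  obtain ⟨T, g, hf⟩ := hM J N X i h (r.r ≫ f)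
  refine ⟨T, fun j => r.i ≫ g j, ?_⟩
  rw [← Category.id_comp f, ← r.retract, Category.assoc, hf, Preadditive.comp_sum]
  simp

/-- Only surjectivity carries content: the projections onto the summands, built from zero morphisms,
recover the components and force injectivity. -/
theorem isCompactObject_iff_finCompact (M : D) : isCompactObject.{t} D M ↔ FinCompact.{t} M := by
  classical
  constructor
  · intro hM J N X i h f
    obtain ⟨x, rfl⟩ := (hM J N (Cofan.mk X i) ⟨h⟩).2 f
    refine ⟨DFinsupp.support x, fun j => x j, ?_⟩
    exact DFinsupp.sumAddHom_apply _ _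
  · intro hM J N c hc
    obtain ⟨hc⟩ := hc
    have h : IsColimit (Cofan.mk c.pt c.inj) := hc.ofIsoColimit (Cofan.ext (Iso.refl _))
    constructor
    · rw [injective_iff_map_eq_zero]
      intro x hx
      have key : ∀ y : DirectSum J fun j => (M ⟶ N j), ∀ j,
          DirectSum.toAddMonoid (fun j => Preadditive.rightComp M (c.inj j)) y ≫
            coprodProj h j = y j := by
        intro y j
        induction y using DirectSum.induction_on with
        | zero => simp
        | of k m =>
          rw [DirectSum.toAddMonoid_of]
          change (m ≫ c.inj k) ≫ coprodProj h j = _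
          rw [Category.assoc]
          by_cases hkj : k = j
          · subst hkj
            rw [coprodProj_same, Category.comp_id, DirectSum.of_eq_same]
          · rw [coprodProj_ne h hkj, comp_zero, DirectSum.of_eq_of_ne _ _ _ (Ne.symm hkj)]
        | add a b ha hb => rw [map_add, Preadditive.add_comp, ha, hb, DirectSum.add_apply]
      ext j
      rw [← key x j, hx, zero_comp]
      rfl
    · intro f
      obtain ⟨T, g, hf⟩ := hM J N c.pt c.inj h f
      refine ⟨∑ j ∈ T, DirectSum.of (fun j => (M ⟶ N j)) j (g j), ?_⟩
      rw [map_sum, hf]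
      refine Finset.sum_congr rfl fun j _ => ?_
      rw [DirectSum.toAddMonoid_of]
      rfl

end Preadditive

/-! ### Compact objects of a triangulated category -/

namespace Pretriangulated

open Triangulated ZeroObject

variable {D : Type*} [Category* D] [Preadditive D] [HasZeroObject D] [HasShift D ℤ]
  [∀ n : ℤ, (shiftFunctor D n).Additive] [Pretriangulated D]

omit [HasZeroObject D] [HasShift D ℤ] [∀ (n : ℤ), (shiftFunctor D n).Additive]
  [Pretriangulated D] in
theorem finCompact_zero {X : D} (hX : IsZero X) : FinCompact.{t} X :=
  fun _ _ _ _ _ _ => ⟨∅, fun _ => 0, hX.eq_of_src _ _⟩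

theorem finCompact_of_distTriang {X Y Z : D} {f : X ⟶ Y} {g : Y ⟶ Z} {h : Z ⟶ X⟦(1 : ℤ)⟧}
    (hT : Triangle.mk f g h ∈ distTriang D) (hX : FinCompact.{t} X) (hZ : FinCompact.{t} Z) :
    FinCompact.{t} Y := by
  classical
  refine finCompact_of_exists_idem fun J N P i hc k => ?_
  obtain ⟨T, h₁⟩ := hX.exists_idem hc (f ≫ k)
  -- Subtracting the part of `k` in the finite subsum `T` kills its restriction to `X`, so the
  -- remainder factors through the compact object `Z` and lies in a second finite subsum `T'`.
  obtain ⟨l, hl⟩ := exists_desc₂ hT (k - k ≫ coprodIdem hc T) (by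
    rw [Preadditive.comp_sub, ← Category.assoc, h₁, sub_self])
  obtain ⟨T', h₂⟩ := hZ.exists_idem hc l
  have h₃ : (k - k ≫ coprodIdem hc T) ≫ coprodIdem hc (T ∪ T') = k - k ≫ coprodIdem hc T := by
    rw [hl, Category.assoc]
    congr 1
    conv_lhs => rw [← h₂]
    rw [Category.assoc, coprodIdem_comp hc Finset.subset_union_right, h₂]
  refine ⟨T ∪ T', ?_⟩
  rwa [Preadditive.sub_comp, Category.assoc, coprodIdem_comp hc Finset.subset_union_left,
    sub_left_inj] at h₃

/-- The shift of a coproduct. -/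
noncomputable def isColimitShift {J : Type*} {N : J → D} {X : D} {i : ∀ j, N j ⟶ X}
    (h : IsColimit (Cofan.mk X i)) (n : ℤ) :
    IsColimit (Cofan.mk (X⟦n⟧) fun j => (i j)⟦n⟧') :=
  isColimitCofanMkObjOfIsColimit (shiftFunctor D n) _ _ h

omit [HasZeroObject D] [Pretriangulated D] in
theorem finCompact_shift {M : D} (hM : FinCompact.{t} M) (n : ℤ) : FinCompact.{t} (M⟦n⟧) := by
  intro J N X i h f
  obtain ⟨T, g, hf⟩ := finCompact_of_retract (Iso.retract (shiftShiftNeg M n)) hM J _ _ _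
    (isColimitShift h (-n)) (f⟦-n⟧')
  choose g' hg' using fun j => (shiftFunctor D (-n)).map_surjective (g j)
  refine ⟨T, g', (shiftFunctor D (-n)).map_injective ?_⟩
  rw [hf, Functor.map_sum]
  simp [hg']

/-! ### Compact objects are retracts of finite cell objects -/

variable (Q : ObjectProperty D)

/-- Finite iterated extensions of objects in `Q`. -/
inductive FiniteCell : D → Prop
  | zero {X : D} (hX : IsZero X) : FiniteCell X
  | of {X : D} (hX : Q X) : FiniteCell X
  | ext {X Y Z : D} {f : X ⟶ Y} {g : Y ⟶ Z} {h : Z ⟶ X⟦(1 : ℤ)⟧}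
      (hT : Triangle.mk f g h ∈ distTriang D) (hX : FiniteCell X) (hZ : FiniteCell Z) :
      FiniteCell Y

/-- A set of compact objects, stable under shifts, which generates the triangulated category. -/
structure IsCompactGenerating : Prop where
  compact : ∀ {X : D}, Q X → FinCompact.{t} X
  shift : ∀ {X : D}, Q X → ∀ n : ℤ, Q (X⟦n⟧)
  isZero : ∀ X : D, (∀ Y, Q Y → ∀ f : Y ⟶ X, f = 0) → IsZero X
  small : ∀ X : D, ∃ (J : Type t) (Y : J → D) (φ : ∀ j, Y j ⟶ X), (∀ j, Q (Y j)) ∧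
    ∀ Z, Q Z → ∀ f : Z ⟶ X, ∃ j g, f = g ≫ φ j

/-- The cofibers of morphisms from coproducts of objects in `Q`. -/
def IsCellStep {X Y : D} (σ : X ⟶ Y) : Prop :=
  ∃ (F : D) (p : F ⟶ X) (w : Y ⟶ F⟦(1 : ℤ)⟧) (J : Type t) (N : J → D) (i : ∀ j, N j ⟶ F),
    Triangle.mk p σ w ∈ distTriang D ∧ (∀ j, Q (N j)) ∧ Nonempty (IsColimit (Cofan.mk F i))

/-- Finite composites of cell steps. -/
inductive IsCellChain : ∀ {X Y : D}, (X ⟶ Y) → Prop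
  | refl (X : D) : IsCellChain (𝟙 X)
  | step {X Y Z : D} {σ : X ⟶ Y} {τ : Y ⟶ Z} (hσ : IsCellStep.{t} Q σ) (hτ : IsCellChain τ) :
      IsCellChain (σ ≫ τ)

variable {Q}

theorem IsCellChain.append {X Y Z : D} {τ : X ⟶ Y} (hτ : IsCellChain.{t} Q τ) {σ : Y ⟶ Z}
    (hσ : IsCellStep.{t} Q σ) : IsCellChain.{t} Q (τ ≫ σ) := by
  induction hτ with
  | refl X =>
    rw [Category.id_comp, ← Category.comp_id σ]
    exact .step hσ (.refl _)
  | step hσ' _ ih =>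
    rw [Category.assoc]
    exact .step hσ' (ih hσ)

namespace FiniteCell

theorem biprod {X Y : D} (hX : FiniteCell Q X) (hY : FiniteCell Q Y) : FiniteCell Q (X ⊞ Y) :=
  .ext (binaryBiproductTriangle_distinguished X Y) hX hY

theorem shift (hQ : ∀ {X : D}, Q X → ∀ n : ℤ, Q (X⟦n⟧)) {X : D} (hX : FiniteCell Q X) (n : ℤ) :
    FiniteCell Q (X⟦n⟧) := by
  induction hX with
  | zero hX => exact .zero ((shiftFunctor D n).map_isZero hX)
  | of hX => exact .of (hQ hX n)
  | ext hT _ _ h₁ h₂ => exact .ext (Triangle.shift_distinguished _ hT n) h₁ h₂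

theorem finCompact (hQ : ∀ {X : D}, Q X → FinCompact.{t} X) {X : D} (hX : FiniteCell Q X) :
    FinCompact.{t} X := by
  induction hX with
  | zero hX => exact finCompact_zero hX
  | of hX => exact hQ hX
  | ext hT _ _ h₁ h₂ => exact finCompact_of_distTriang hT h₁ h₂

/-- Finite subsums of a coproduct of objects in `Q`. -/
theorem exists_subsum {J : Type*} {N : J → D} {X : D} {i : ∀ j, N j ⟶ X} (hN : ∀ j, Q (N j))
    (h : IsColimit (Cofan.mk X i)) (T : Finset J) :
    ∃ (F : D) (b : F ⟶ X) (r : X ⟶ F), FiniteCell Q F ∧ b ≫ r = 𝟙 F ∧ r ≫ b = coprodIdem h T := by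
  classical
  induction T using Finset.induction_on with
  | empty =>
    exact ⟨0, 0, 0, .zero (isZero_zero D), (isZero_zero D).eq_of_src _ _, by simp [coprodIdem]⟩
  | insert j T hj ih =>
    obtain ⟨F, b, r, hF, h₁, h₂⟩ := ih
    have h₃ : i j ≫ r = 0 := by
      rw [← Category.comp_id r, ← h₁, reassoc_of% h₂, ← Category.assoc,
        ι_coprodIdem_of_notMem h hj, zero_comp]
    have h₄ : b ≫ coprodProj h j = 0 := by
      rw [← Category.id_comp b, ← h₁, Category.assoc, Category.assoc, reassoc_of% h₂, coprodIdem,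
        Preadditive.sum_comp]
      rw [Finset.sum_eq_zero, comp_zero]
      intro k hk
      rw [Category.assoc, coprodProj_ne h (by rintro rfl; exact hj hk), comp_zero]
    refine ⟨F ⊞ N j, biprod.desc b (i j), biprod.lift r (coprodProj h j), hF.biprod (.of (hN j)),
      ?_, ?_⟩
    · ext <;> simp [h₁, h₃, h₄]
    · rw [biprod.lift_desc, h₂, coprodIdem, coprodIdem, Finset.sum_insert hj, add_comm]

/-- Morphisms from a compact object to a coproduct of objects in `Q` factor through a finite
subsum. -/
theorem exists_fac {K : D} (hK : FinCompact.{t} K) {J : Type t} {N : J → D} {X : D}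
    {i : ∀ j, N j ⟶ X} (hN : ∀ j, Q (N j)) (h : IsColimit (Cofan.mk X i)) (f : K ⟶ X) :
    ∃ (F : D) (a : K ⟶ F) (b : F ⟶ X), FiniteCell Q F ∧ Mono b ∧ f = a ≫ b := by
  obtain ⟨T, hT⟩ := hK.exists_idem h f
  obtain ⟨F, b, r, hF, h₁, h₂⟩ := exists_subsum hN h T
  have : Mono b := mono_of_mono_fac h₁
  exact ⟨F, f ≫ r, b, hF, this, by rw [Category.assoc, h₂, hT]⟩

end FiniteCell

/-- By induction on the chain, `f ≫ σ` factors through a finite cell object `E`. The obstruction to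
lifting `E` along `σ` involves only finitely many cells of `F`; passing to the fiber `E'` over these
gives a finite object mapping to `X`, and the error term comes from `F`, hence from finitely many
cells. -/
theorem IsCellChain.exists_fac (hQ : IsCompactGenerating.{t} Q) {X Y : D} {τ : X ⟶ Y}
    (hτ : IsCellChain.{t} Q τ) {K : D} (hK : FinCompact.{t} K) (f : K ⟶ X) (hf : f ≫ τ = 0) :
    ∃ (F : D) (a : K ⟶ F) (b : F ⟶ X), FiniteCell Q F ∧ f = a ≫ b := by
  induction hτ with
  | refl X =>
    exact ⟨0, 0, 0, .zero (isZero_zero D), by simpa using hf⟩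
  | @step X X' Y σ τ hσ _ ih =>
    obtain ⟨E, v, s, hE, hv⟩ := ih (f ≫ σ) (by rwa [Category.assoc])
    obtain ⟨F, p, w, J, N, i, hT, hN, ⟨hc⟩⟩ := hσ
    obtain ⟨F', a, b, hF', _, hab⟩ := FiniteCell.exists_fac (hE.finCompact hQ.compact)
      (fun j => hQ.shift (hN j) 1) (isColimitShift hc 1) (s ≫ w)
    obtain ⟨E', c, d, hE'⟩ := distinguished_cocone_triangle₁ a
    have hE'' : FiniteCell Q E' :=
      .ext (inv_rot_of_distTriang _ hE') (hF'.shift hQ.shift (-1)) hE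
    obtain ⟨(k : E' ⟶ X), (hk : c ≫ s = k ≫ σ), -⟩ :=
      complete_distinguished_triangle_morphism₁ _ _ hE' (distTriang_rotate hT)
      s b hab.symm
    -- The factor `b` is a monomorphism, so `v ≫ a = 0` follows from `v ≫ s ≫ w = f ≫ σ ≫ w = 0`.
    obtain ⟨v', hv'⟩ := exists_lift₁ hE' v (by
      rw [← cancel_mono b, Category.assoc, ← hab, ← Category.assoc, ← hv, Category.assoc,
        distTriang_comp₂₃ hT, comp_zero, zero_comp])
    obtain ⟨l, hl⟩ := exists_lift₁ hT (f - v' ≫ k) (by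
      rw [Preadditive.sub_comp, hv, Category.assoc, ← hk, ← Category.assoc, ← hv', sub_self])
    obtain ⟨F'', a', b', hF'', -, hab'⟩ := FiniteCell.exists_fac hK hN hc l
    exact ⟨E' ⊞ F'', biprod.lift v' a', biprod.desc k (b' ≫ p), hE''.biprod hF'', by
      rw [biprod.lift_desc, ← Category.assoc, ← hab', ← hl, add_sub_cancel]⟩

theorem IsCompactGenerating.exists_isCellStep [HasCoproducts.{t} D]
    (hQ : IsCompactGenerating.{t} Q) (X : D) :
    ∃ (Y : D) (σ : X ⟶ Y), IsCellStep.{t} Q σ ∧ ∀ Z, Q Z → ∀ f : Z ⟶ X, f ≫ σ = 0 := by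
  obtain ⟨J, N, φ, hN, hφ⟩ := hQ.small X
  obtain ⟨Y, σ, w, hT⟩ := distinguished_cocone_triangle (Limits.Sigma.desc φ)
  refine ⟨Y, σ, ⟨_, _, w, J, N, Limits.Sigma.ι N, hT, hN, ⟨coproductIsCoproduct N⟩⟩, fun Z hZ f => ?_⟩
  obtain ⟨j, g, rfl⟩ := hφ Z hZ f
  rw [← Limits.Sigma.ι_desc φ j, Category.assoc, Category.assoc, distTriang_comp₁₂ hT, comp_zero,
    comp_zero]

omit [HasZeroObject D] [Pretriangulated D] in
theorem comp_shift_eq_zero (hQ : ∀ {X : D}, Q X → ∀ n : ℤ, Q (X⟦n⟧)) {X Y : D} {h : X ⟶ Y}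
    (hh : ∀ Z, Q Z → ∀ f : Z ⟶ X, f ≫ h = 0) {Z : D} (hZ : Q Z) (n : ℤ) (f : Z ⟶ X⟦n⟧) :
    f ≫ h⟦n⟧' = 0 := by
  apply (shiftFunctor D (-n)).map_injective
  rw [Functor.map_comp, Functor.map_zero, ← cancel_mono (shiftShiftNeg Y n).hom, zero_comp]
  have := (shiftFunctorCompIsoId D n (-n) (add_neg_cancel n)).hom.naturality h
  refine Eq.trans ?_ (hh _ (hQ hZ (-n)) (f⟦-n⟧' ≫ (shiftShiftNeg X n).hom))
  rw [Category.assoc, Category.assoc]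
  exact congrArg _ this

/-- A compact object is killed by a finite chain of cell steps. -/
theorem IsCompactGenerating.exists_isCellChain [HasCoproducts.{t} D]
    (hQ : IsCompactGenerating.{t} Q) {M : D} (hM : FinCompact.{t} M) :
    ∃ (Y : D) (τ : M ⟶ Y), IsCellChain.{t} Q τ ∧ τ = 0 := by
  -- The tower `M = X 0 ⟶ X 1 ⟶ ⋯`, in which each map kills every morphism from an object of `Q`.
  obtain ⟨X, σ, τ, hτσ, hσ₀, hτ⟩ : ∃ (X : ℕ → D) (σ : ∀ n, X n ⟶ X (n + 1)) (τ : ∀ n, M ⟶ X n),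
      (∀ n, τ (n + 1) = τ n ≫ σ n) ∧ (∀ n Z, Q Z → ∀ f : Z ⟶ X n, f ≫ σ n = 0) ∧
        ∀ n, IsCellChain.{t} Q (τ n) := by
    choose next σ hσ hσ₀ using hQ.exists_isCellStep
    let X : ℕ → D := fun n => Nat.rec M (fun _ Y => next Y) n
    let τ : ∀ n, M ⟶ X n := fun n => Nat.rec (𝟙 M) (fun n f => f ≫ σ (X n)) n
    refine ⟨X, fun n => σ (X n), τ, fun n => rfl, fun n => hσ₀ (X n), fun n => ?_⟩
    induction n with
    | zero => exact .refl M
    | succ n ih => exact ih.append (hσ (X n))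
  let N : ULift.{t} ℕ → D := fun n => X n.down
  obtain ⟨P, i, ⟨hc⟩⟩ : ∃ (P : D) (i : ∀ n, N n ⟶ P), Nonempty (IsColimit (Cofan.mk P i)) :=
    ⟨∐ N, _, ⟨coproductIsCoproduct N⟩⟩
  obtain ⟨s, his⟩ := exists_coprod_desc hc fun n => σ n.down ≫ i ⟨n.down + 1⟩
  have hs : ∀ Z, Q Z → ∀ f : Z ⟶ P, f ≫ s = 0 := fun Z hZ f => by
    obtain ⟨T, g, hf⟩ := hQ.compact hZ _ _ _ _ hc f
    rw [hf, Preadditive.sum_comp]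
    refine Finset.sum_eq_zero fun n _ => ?_
    rw [Category.assoc, his, ← Category.assoc, hσ₀ _ _ hZ, zero_comp]
  -- The cone of `𝟙 - s` is the homotopy colimit of the tower. Since `s` kills all maps from objects
  -- of `Q`, composition with `𝟙 - s` is the identity on these maps, so the cone receives only zero
  -- maps from `Q`.
  have : IsIso (𝟙 _ - s) := by
    obtain ⟨C, v, w, hT⟩ := distinguished_cocone_triangle (𝟙 _ - s)
    refine (Triangle.isZero₃_iff_isIso₁ _ hT).1 (hQ.isZero C fun Z hZ (f : Z ⟶ C) => ?_)
    have h₁ : f ≫ w = 0 := by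
      have := distTriang_comp₃₁ hT
      rw [Functor.map_sub, Functor.map_id, Preadditive.comp_sub, Category.comp_id] at this
      rw [sub_eq_zero.1 this, ← Category.assoc,
        comp_shift_eq_zero hQ.shift hs hZ 1 (f ≫ w)]
    obtain ⟨l, rfl⟩ := exists_lift₂ hT f h₁
    have h₂ : l ≫ (𝟙 _ - s) = l := by rw [Preadditive.comp_sub, hs Z hZ, sub_zero, Category.comp_id]
    rw [← h₂, Category.assoc, distTriang_comp₁₂ hT, comp_zero]
  -- Formally `m` is the sum over `n` of `τ n` into the `n`-th summand. Compactness allows only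
  -- finitely many nonzero components, so some `τ n` vanishes.
  let m : M ⟶ P := τ 0 ≫ i ⟨0⟩ ≫ inv (𝟙 _ - s)
  have hm : m - m ≫ s = τ 0 ≫ i ⟨0⟩ := by
    have h : m ≫ (𝟙 P - s) = τ 0 ≫ i ⟨0⟩ := by simp only [m, Category.assoc, IsIso.inv_hom_id,
      Category.comp_id]
    rwa [Preadditive.comp_sub, Category.comp_id] at h
  have h₀ : s ≫ coprodProj hc ⟨0⟩ = 0 := by
    refine coprod_hom_ext hc fun n => ?_
    rw [← Category.assoc, his, Category.assoc, coprodProj_ne hc (by simp), comp_zero, comp_zero]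
  have h₁ : ∀ n : ℕ, s ≫ coprodProj hc ⟨n + 1⟩ = coprodProj hc ⟨n⟩ ≫ σ n := fun n => by
    refine coprod_hom_ext hc fun k => ?_
    rw [← Category.assoc, his, Category.assoc]
    by_cases hk : k = ⟨n⟩
    · subst hk
      rw [coprodProj_same_assoc hc, coprodProj_same hc, Category.comp_id]
    · rw [coprodProj_ne hc (by simpa [ULift.ext_iff] using hk), coprodProj_ne_assoc hc hk,
        comp_zero, zero_comp]
  have hτ' : ∀ n : ℕ, m ≫ coprodProj hc ⟨n⟩ = τ n := fun n => by
    induction n with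
    | zero =>
      have := congrArg (· ≫ coprodProj hc ⟨0⟩) hm
      simp only [Preadditive.sub_comp, Category.assoc, h₀, comp_zero, sub_zero] at this
      rw [this, coprodProj_same, Category.comp_id]
    | succ n ih =>
      have := congrArg (· ≫ coprodProj hc ⟨n + 1⟩) hm
      simp only [Preadditive.sub_comp, Category.assoc, h₁, reassoc_of% ih] at this
      rw [coprodProj_ne hc (by simp), comp_zero] at this
      rw [hτσ, sub_eq_zero.1 this]
  obtain ⟨T, g, hT⟩ := hM _ _ _ _ hc m
  obtain ⟨n, hn⟩ := Infinite.exists_notMem_finset T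
  refine ⟨_, _, hτ n.down, ?_⟩
  rw [← hτ', hT, Preadditive.sum_comp]
  refine Finset.sum_eq_zero fun k hk => ?_
  rw [Category.assoc, coprodProj_ne hc (by rintro rfl; exact hn hk), comp_zero]

/-- A compact object is a retract of a finite cell object. -/
theorem IsCompactGenerating.exists_retract [HasCoproducts.{t} D]
    (hQ : IsCompactGenerating.{t} Q) {M : D} (hM : FinCompact.{t} M) :
    ∃ F : D, FiniteCell Q F ∧ Nonempty (Retract M F) := by
  obtain ⟨Y, τ, hτ, h₀⟩ := hQ.exists_isCellChain hM
  obtain ⟨F, a, b, hF, h⟩ := hτ.exists_fac hQ hM (𝟙 M) (by rw [h₀, comp_zero])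
  exact ⟨F, hF, ⟨⟨a, b, h.symm⟩⟩⟩

variable [IsTriangulated D] {G : Type*} [AddCommGroup G] {S : SiltingInvariant D G}

theorem FiniteCell.exists_isRes (hQ : ∀ X, Q X → ∃ x, S.IsRes X x) {X : D}
    (hX : FiniteCell Q X) : ∃ x, S.IsRes X x := by
  induction hX with
  | zero hX => exact ⟨_, (SiltingInvariant.IsRes.of_P S.zero).of_iso ((isZero_zero D).iso hX)⟩
  | of hX => exact hQ _ hX
  | ext hT _ _ h₁ h₂ =>
    obtain ⟨x, hx⟩ := h₁
    obtain ⟨y, hy⟩ := h₂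
    exact ⟨_, hx.of_distTriang hy hT⟩

theorem IsCompactGenerating.exists_isRes [HasCoproducts.{t} D]
    (hQ : IsCompactGenerating.{t} Q) (hS : ∀ X, Q X → ∃ x, S.IsRes X x) {M : D}
    (hM : FinCompact.{t} M) : ∃ x, S.IsRes M x := by
  obtain ⟨F, hF, ⟨r⟩⟩ := hQ.exists_retract hM
  obtain ⟨x, hx⟩ := hF.exists_isRes hS
  exact hx.exists_of_retract r

end Pretriangulated

end CategoryTheory

/-! ### Coproducts and compact objects in the derived category -/

namespace CategoryTheory

section

variable {C : Type*} [Category* C] [Abelian C]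

/-- A family of compact projective generators of an abelian category. -/
structure IsCompactProjGenerating {ι : Type*} (G : ι → C) : Prop where
  projective : ∀ i, Projective (G i)
  compact : ∀ i, FinCompact.{t} (G i)
  isZero : ∀ X : C, (∀ i (f : G i ⟶ X), f = 0) → IsZero X

variable {ι : Type*} {G : ι → C}

/-- Exactness may be tested with morphisms from a family of projective generators. -/
theorem ShortComplex.exact_of_exists_lift (hG : ∀ i, Projective (G i))
    (h₀ : ∀ X : C, (∀ i (f : G i ⟶ X), f = 0) → IsZero X) (S : ShortComplex C)
    (hS : ∀ i (x : G i ⟶ S.X₂), x ≫ S.g = 0 → ∃ y, y ≫ S.f = x) : S.Exact := by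
  rw [S.exact_iff_isZero_homology]
  refine h₀ _ fun i f => ?_
  have := hG i
  obtain ⟨y, hy⟩ := hS i (Projective.factorThru f S.homologyπ ≫ S.iCycles) (by simp)
  have : y ≫ S.toCycles = Projective.factorThru f S.homologyπ := by
    rw [← cancel_mono S.iCycles, Category.assoc, S.toCycles_i, hy]
  rw [← Projective.factorThru_comp f S.homologyπ, ← this, Category.assoc,
    S.toCycles_comp_homologyπ, comp_zero]

end

end CategoryTheory

/-! ### Morphisms in the derived category, represented by chain maps -/

namespace DerivedCategory

variable {C : Type*} [Category* C] [Abelian C] {P : C}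

/-- A cycle of degree `n` gives a morphism from a complex concentrated in degree `n`. -/
theorem exists_single_hom {K : CochainComplex C ℤ} (n : ℤ) (x : P ⟶ K.X n)
    (hx : x ≫ K.d n (n + 1) = 0) :
    ∃ φ : (HomologicalComplex.single C (ComplexShape.up ℤ) n).obj P ⟶ K,
      (HomologicalComplex.singleObjXSelf (ComplexShape.up ℤ) n P).inv ≫ φ.f n = x := by
  refine ⟨HomologicalComplex.mkHomFromSingle x (fun k hk => ?_), ?_⟩
  · obtain rfl : n + 1 = k := hk
    exact hx
  · simp

variable [HasDerivedCategory.{w} C]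

instance isKProjective_single (n : ℤ) [Projective P] :
    CochainComplex.IsKProjective ((HomologicalComplex.single C (ComplexShape.up ℤ) n).obj P) := by
  have : ∀ m, Projective (((HomologicalComplex.single C (ComplexShape.up ℤ) n).obj P).X m) := by
    intro m
    by_cases h : m = n
    · subst h
      exact Projective.of_iso (HomologicalComplex.singleObjXSelf (ComplexShape.up ℤ) m P).symm
        inferInstance
    · have := HomologicalComplex.isZero_single_obj_X (ComplexShape.up ℤ) n P m h
      exact Projective.of_iso (this.iso (isZero_zero C)).symm inferInstance
  have : CochainComplex.IsStrictlyLE ((HomologicalComplex.single C (ComplexShape.up ℤ) n).obj P) n :=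
    inferInstanceAs (CochainComplex.IsStrictlyLE ((CochainComplex.singleFunctor C n).obj P) n)
  exact CochainComplex.isKProjective_of_projective _ n

variable {K L : CochainComplex C ℤ}

/-- From a K-projective complex, morphisms in the derived category are homotopy classes of chain
maps; this is the surjective half, the next lemma the injective half. -/
theorem exists_Q_map_eq [K.IsKProjective] (f : Q.obj K ⟶ Q.obj L) : ∃ φ : K ⟶ L, Q.map φ = f := by
  obtain ⟨a, ha⟩ := (CochainComplex.IsKProjective.Qh_map_bijective K
    ((HomotopyCategory.quotient _ _).obj L)).2
    ((quotientCompQhIso C).hom.app K ≫ f ≫ (quotientCompQhIso C).inv.app L)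
  obtain ⟨φ, rfl⟩ := (HomotopyCategory.quotient _ _).map_surjective a
  refine ⟨φ, ?_⟩
  have h := quotientCompQhIso_hom_naturality φ
  rw [ha] at h
  rw [← cancel_epi ((quotientCompQhIso C).hom.app K), ← h]
  simp

theorem homotopy_of_Q_map_eq_zero [K.IsKProjective] (φ : K ⟶ L) (h : Q.map φ = 0) :
    Nonempty (Homotopy φ 0) := by
  refine ⟨HomotopyCategory.homotopyOfEq _ _
    ((CochainComplex.IsKProjective.Qh_map_bijective K
      ((HomotopyCategory.quotient _ _).obj L)).1 ?_)⟩
  have h' := quotientCompQhIso_hom_naturality φ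
  rw [h, comp_zero] at h'
  rw [Functor.map_zero, Functor.map_zero]
  rw [← cancel_mono ((quotientCompQhIso C).hom.app L), zero_comp]
  exact h'

/-- A morphism of complexes which vanishes in the derived category factors through an acyclic
complex. -/
theorem exists_fac_of_Q_map_eq_zero (g : K ⟶ L) (h : Q.map g = 0) :
    ∃ (N : CochainComplex C ℤ) (a : K ⟶ N) (b : N ⟶ L), IsZero (Q.obj N) ∧ g = a ≫ b := by
  have h' := quotientCompQhIso_hom_naturality g
  rw [h, comp_zero] at h'
  have h₁ : Qh.map ((HomotopyCategory.quotient _ _).map g) =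
    Qh.map ((HomotopyCategory.quotient C (ComplexShape.up ℤ)).map (0 : K ⟶ L)) := by
    rw [← cancel_mono ((quotientCompQhIso C).hom.app L)]
    refine h'.trans ?_
    simp
  obtain ⟨X, s, hs, hfac⟩ := (MorphismProperty.map_eq_iff_precomp Qh
    (HomotopyCategory.quasiIso C (ComplexShape.up ℤ)) _ _).1 h₁
  obtain ⟨X, rfl⟩ := HomotopyCategory.quotient_obj_surjective X
  obtain ⟨s, rfl⟩ := (HomotopyCategory.quotient _ _).map_surjective s
  rw [← isIso_Qh_map_iff] at hs
  have hs' : IsIso (Q.map s) :=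
    (NatIso.isIso_map_iff (quotientCompQhIso C) s).1 hs
  rw [← Functor.map_comp, ← Functor.map_comp, comp_zero] at hfac
  have H := HomotopyCategory.homotopyOfEq _ _ hfac
  -- A quasi-isomorphism `s` makes `s ≫ g` null-homotopic. The homotopy is precisely the datum
  -- extending `g` to the mapping cone of `s`, which is acyclic.
  obtain ⟨z, hz⟩ := CochainComplex.HomComplex.Cochain.equivHomotopy _ _ H
  refine ⟨CochainComplex.mappingCone s, CochainComplex.mappingCone.inr s,
    CochainComplex.mappingCone.desc s z g ?_, ?_, ?_⟩
  · simpa using hz.symm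
  · have := mappingCone_triangle_distinguished s
    exact (Triangle.isZero₃_iff_isIso₁ _ this).2 hs'
  · simp
end DerivedCategory

namespace CategoryTheory

theorem Functor.map_coprodIdem {D D' : Type*} [Category* D] [Preadditive D] [Category* D']
    [Preadditive D'] (F : D ⥤ D') [F.Additive] {J : Type*} {N : J → D} {X : D}
    {i : ∀ j, N j ⟶ X} (h : IsColimit (Cofan.mk X i))
    (h' : IsColimit (Cofan.mk (F.obj X) fun j => F.map (i j))) (T : Finset J) :
    F.map (coprodIdem h T) = coprodIdem h' T := by
  refine coprod_hom_ext h' fun j => ?_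
  rw [← F.map_comp]
  by_cases hj : j ∈ T
  · rw [ι_coprodIdem_of_mem h hj, ι_coprodIdem_of_mem h' hj]
  · rw [ι_coprodIdem_of_notMem h hj, ι_coprodIdem_of_notMem h' hj, F.map_zero]

/-- Compactness may be tested on one coproduct for each family, up to isomorphism. -/
theorem finCompact_of_exists {D : Type*} [Category* D] [Preadditive D] {M : D}
    (hM : ∀ (J : Type t) (N : J → D), ∃ (N' : J → D) (_ : ∀ j, N j ≅ N' j) (X : D)
      (i : ∀ j, N' j ⟶ X), Nonempty (IsColimit (Cofan.mk X i)) ∧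
        ∀ f : M ⟶ X, ∃ (T : Finset J) (g : ∀ j, M ⟶ N' j), f = ∑ j ∈ T, g j ≫ i j) :
    FinCompact.{t} M := by
  intro J N Y i' h' f
  obtain ⟨N', e, X, i, ⟨h⟩, H⟩ := hM J N
  obtain ⟨a, ha⟩ := exists_coprod_desc h' fun j => (e j).hom ≫ i j
  obtain ⟨b, hb⟩ := exists_coprod_desc h fun j => (e j).inv ≫ i' j
  obtain ⟨T, g, hf⟩ := H (f ≫ a)
  have hab : a ≫ b = 𝟙 Y := coprod_hom_ext h' fun j => by
    rw [← Category.assoc, ha, Category.assoc, hb]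
    simp
  refine ⟨T, fun j => g j ≫ (e j).inv, ?_⟩
  rw [← Category.comp_id f, ← hab, ← Category.assoc, hf, Preadditive.sum_comp]
  simp [hb]

end CategoryTheory

/-! ### Coproducts in the derived category -/

namespace DerivedCategory

section

variable {C : Type*} [Category* C] [Abelian C] [HasCoproducts.{t} C] {P : C}

/-- Complexes concentrated in one degree. -/
local notation "Sg" => HomologicalComplex.single _ (ComplexShape.up ℤ)

/-- A chain map from a complex concentrated in degree `n` is determined by its component there, and
evaluation at `n` preserves coproducts. -/
theorem finCompact_single (hP : FinCompact.{t} P) (n : ℤ) :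
    FinCompact.{t} ((Sg n).obj P : CochainComplex C ℤ) := by
  refine finCompact_of_exists_idem fun J N X i h f => ?_
  have h' := isColimitCofanMkObjOfIsColimit (HomologicalComplex.eval C (ComplexShape.up ℤ) n) _ _ h
  obtain ⟨T, hT⟩ := hP.exists_idem h'
    ((HomologicalComplex.singleObjXSelf (ComplexShape.up ℤ) n P).inv ≫ f.f n)
  refine ⟨T, HomologicalComplex.from_single_hom_ext ?_⟩
  rw [← cancel_epi (HomologicalComplex.singleObjXSelf (ComplexShape.up ℤ) n P).inv,
    HomologicalComplex.comp_f, ← Category.assoc]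
  exact (congrArg (_ ≫ ·) (Functor.map_coprodIdem _ h h' T)).trans hT

end

section

variable {C : Type u} [Category.{t} C] [Abelian C] [HasDerivedCategory.{w} C]
  {ι : Type*} {G : ι → C}

/-- Objects of the derived category are detected by morphisms from shifted generators. -/
theorem isZero_of_forall_single (hG : IsCompactProjGenerating.{t} G) (X : DerivedCategory C)
    (hX : ∀ i k (f : (singleFunctor C k).obj (G i) ⟶ X), f = 0) : IsZero X := by
  obtain ⟨K, ⟨e⟩⟩ : ∃ K : CochainComplex C ℤ, Nonempty (Q.obj K ≅ X) :=
    ⟨Q.objPreimage X, ⟨Q.objObjPreimageIso X⟩⟩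
  refine IsZero.of_iso ?_ e.symm
  have hK : ∀ k, K.ExactAt k := fun k => by
    rw [HomologicalComplex.exactAt_iff' K (k - 1) k (k + 1) (by simp) (by simp)]
    refine ShortComplex.exact_of_exists_lift hG.projective hG.isZero _ fun i x hx => ?_
    obtain ⟨φ, hφ⟩ := exists_single_hom k x hx
    have := hG.projective i
    obtain ⟨H⟩ := homotopy_of_Q_map_eq_zero φ (by
      rw [← cancel_mono e.hom, zero_comp]
      exact hX i k (Q.map φ ≫ e.hom))
    -- The source has zero differential, so in degree `k` the homotopy writes the cycle `x` as a
    -- boundary.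
    have hH := H.comm k
    rw [HomologicalComplex.zero_f, add_zero, dNext_eq _ (show (ComplexShape.up ℤ).Rel k (k + 1) by simp),
      prevD_eq _ (show (ComplexShape.up ℤ).Rel (k - 1) k by simp)] at hH
    refine ⟨(HomologicalComplex.singleObjXSelf (ComplexShape.up ℤ) k (G i)).inv ≫ H.hom k (k - 1), ?_⟩
    rw [HomologicalComplex.single_obj_d, zero_comp, zero_add] at hH
    rw [← hφ, hH]
    exact Category.assoc _ _ _
  have : QuasiIso (0 : K ⟶ K) :=
    ⟨fun i => (quasiIsoAt_iff_exactAt _ i (hK i)).2 (hK i)⟩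
  have h : IsIso (Q.map (0 : K ⟶ K)) := inferInstance
  rw [Functor.map_zero] at h
  exact (IsZero.iff_id_eq_zero _).2 (by rw [← IsIso.hom_inv_id (0 : Q.obj K ⟶ Q.obj K), zero_comp])

theorem isIso_of_forall_single (hG : IsCompactProjGenerating.{t} G) {X Y : DerivedCategory C}
    (s : X ⟶ Y)
    (h₁ : ∀ i k (f : (singleFunctor C k).obj (G i) ⟶ Y), ∃ g, g ≫ s = f)
    (h₂ : ∀ i k (f : (singleFunctor C k).obj (G i) ⟶ X), f ≫ s = 0 → f = 0) : IsIso s := by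
  obtain ⟨Z, v, w, hT⟩ := distinguished_cocone_triangle s
  refine (Triangle.isZero₃_iff_isIso₁ _ hT).1 (isZero_of_forall_single hG Z fun i k f => ?_)
  -- Shifted by `-1`, the morphism `f ≫ w` becomes a map from a shifted generator to `X` that is
  -- killed by `s`, so `h₂` applies.
  have hw : f ≫ w = 0 := by
    apply (shiftFunctor _ (-1 : ℤ)).map_injective
    rw [Functor.map_zero, ← cancel_mono (shiftShiftNeg X (1 : ℤ)).hom, zero_comp,
      ← cancel_epi (((singleFunctors C).shiftIso (-1) (k + 1) k (by lia)).inv.app (G i)), comp_zero]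
    apply h₂
    have h₃ := (shiftFunctorCompIsoId (DerivedCategory C) (1 : ℤ) (-1) (by simp)).hom.naturality s
    have h₄ := congrArg (shiftFunctor _ (-1 : ℤ)).map (f ≫= distTriang_comp₃₁ hT)
    rw [comp_zero, Functor.map_zero, Functor.map_comp, Functor.map_comp] at h₄
    have h₅ : (((shiftFunctor _ (-1 : ℤ)).map (f ≫ w)) ≫ (shiftShiftNeg X (1 : ℤ)).hom) ≫ s = 0 := by
      rw [Category.assoc]
      refine (congrArg _ h₃.symm).trans ?_
      rw [Functor.map_comp, Category.assoc]
      refine Eq.trans ?_ (congrArg (· ≫ (shiftFunctorCompIsoId (DerivedCategory C) (1 : ℤ) (-1)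
        (by simp)).hom.app Y) h₄ |>.trans zero_comp)
      simp only [Category.assoc]
      rfl
    rw [Category.assoc, h₅, comp_zero]
  obtain ⟨l, rfl⟩ := exists_lift₂ hT f hw
  obtain ⟨g, rfl⟩ := h₁ i k l
  rw [Category.assoc, distTriang_comp₁₂ hT, comp_zero]

variable [HasCoproducts.{t} C]

/-- Morphisms from a shifted compact projective object to a coproduct of complexes are finite sums
of morphisms to the summands. -/
theorem exists_single_eq_sum {J : Type t}
    {K : J → CochainComplex C ℤ} {X : CochainComplex C ℤ} {i : ∀ j, K j ⟶ X}
    (h : IsColimit (Cofan.mk X i)) {P : C} [Projective P] (hP : FinCompact.{t} P) (k : ℤ)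
    (f : (singleFunctor C k).obj P ⟶ Q.obj X) :
    ∃ (T : Finset J) (g : ∀ j, (singleFunctor C k).obj P ⟶ Q.obj (K j)),
      f = ∑ j ∈ T, g j ≫ Q.map (i j) ∧ ∀ j, g j = f ≫ Q.map (coprodProj h j) := by
  obtain ⟨φ, rfl⟩ := exists_Q_map_eq (K := (HomologicalComplex.single _ (ComplexShape.up ℤ) k).obj P) f
  obtain ⟨T, hT⟩ := (finCompact_single hP k).exists_idem h φ
  refine ⟨T, _, ?_, fun j => rfl⟩
  conv_lhs => rw [← hT]
  simp only [coprodIdem, Preadditive.comp_sum, Functor.map_sum, Functor.map_comp]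
  exact Finset.sum_congr rfl fun j _ => (Category.assoc _ _ _).symm

theorem isZero_Q_coprod (hG : IsCompactProjGenerating.{t} G) {J : Type t}
    {K : J → CochainComplex C ℤ} {X : CochainComplex C ℤ} {i : ∀ j, K j ⟶ X}
    (h : IsColimit (Cofan.mk X i)) (hK : ∀ j, IsZero (Q.obj (K j))) : IsZero (Q.obj X) := by
  refine isZero_of_forall_single hG _ fun a k f => ?_
  have := hG.projective a
  obtain ⟨T, g, hf, -⟩ := exists_single_eq_sum h (hG.compact a) k f
  rw [hf]
  exact Finset.sum_eq_zero fun j _ => by rw [(hK j).eq_of_tgt (g j) 0, zero_comp]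

/-- A coproduct of quasi-isomorphisms is again one: maps from shifted generators see only finitely
many summands, where `s j` can be inverted. -/
theorem isIso_Q_coprod (hG : IsCompactProjGenerating.{t} G) {J : Type t}
    {K K' : J → CochainComplex C ℤ} {X X' : CochainComplex C ℤ} {i : ∀ j, K j ⟶ X}
    {i' : ∀ j, K' j ⟶ X'} (h : IsColimit (Cofan.mk X i)) (h' : IsColimit (Cofan.mk X' i'))
    (s : ∀ j, K' j ⟶ K j) (hs : ∀ j, IsIso (Q.map (s j))) (σ : X' ⟶ X)
    (hσ : ∀ j, i' j ≫ σ = s j ≫ i j) : IsIso (Q.map σ) := by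
  refine isIso_of_forall_single hG _ (fun a k f => ?_) fun a k f hf => ?_
  all_goals have := hG.projective a
  · obtain ⟨T, g, hf, -⟩ := exists_single_eq_sum h (hG.compact a) k f
    refine ⟨∑ j ∈ T, (g j ≫ inv (Q.map (s j))) ≫ Q.map (i' j), ?_⟩
    rw [hf, Preadditive.sum_comp]
    refine Finset.sum_congr rfl fun j _ => ?_
    rw [Category.assoc, Category.assoc, ← Q.map_comp, hσ, Q.map_comp, IsIso.inv_hom_id_assoc]
  · obtain ⟨T, g, hf', hg⟩ := exists_single_eq_sum h' (hG.compact a) k f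
    rw [hf']
    refine Finset.sum_eq_zero fun j _ => ?_
    have hj : σ ≫ coprodProj h j = coprodProj h' j ≫ s j := coprod_hom_ext h' fun l => by
      rw [← Category.assoc, hσ, Category.assoc]
      by_cases hl : l = j
      · subst hl
        rw [coprodProj_same, coprodProj_same_assoc, Category.comp_id]
      · rw [coprodProj_ne h hl, coprodProj_ne_assoc h' hl, comp_zero, zero_comp]
    have hgj : g j ≫ Q.map (s j) = 0 := by
      rw [hg, Category.assoc, ← Q.map_comp, ← hj, Q.map_comp, ← Category.assoc, hf, zero_comp]
    have := hs j
    rw [(cancel_mono (Q.map (s j))).1 (hgj.trans zero_comp.symm), zero_comp]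

theorem Q_coprod_hom_eq_zero (hG : IsCompactProjGenerating.{t} G) {J : Type t}
    {K : J → CochainComplex C ℤ} {X : CochainComplex C ℤ} {i : ∀ j, K j ⟶ X}
    (h : IsColimit (Cofan.mk X i)) {Y : DerivedCategory C} (f : Q.obj X ⟶ Y)
    (hf : ∀ j, Q.map (i j) ≫ f = 0) : f = 0 := by
  obtain ⟨L, ⟨e⟩⟩ : ∃ L : CochainComplex C ℤ, Nonempty (Q.obj L ≅ Y) :=
    ⟨Q.objPreimage Y, ⟨Q.objObjPreimageIso Y⟩⟩
  -- In a left fraction the numerator `g` is a chain map out of the coproduct. It vanishes in the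
  -- derived category on each summand, hence factors there through an acyclic complex; the coproduct
  -- of these complexes is acyclic and carries `g`.
  obtain ⟨L', g, s, _, hg⟩ := left_fac (f ≫ e.inv)
  have hg₀ : ∀ j, Q.map (i j ≫ g) = 0 := fun j => by
    rw [← cancel_mono (inv (Q.map s)), Q.map_comp, Category.assoc, ← hg, ← Category.assoc, hf,
      zero_comp, zero_comp]
  choose N a b hN hab using fun j => exists_fac_of_Q_map_eq_zero _ (hg₀ j)
  obtain ⟨Z, ι', ⟨hZ⟩⟩ : ∃ (Z : CochainComplex C ℤ) (ι' : ∀ j, N j ⟶ Z),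
    Nonempty (IsColimit (Cofan.mk Z ι')) := ⟨∐ N, _, ⟨coproductIsCoproduct N⟩⟩
  obtain ⟨α, hα⟩ := exists_coprod_desc h fun j => a j ≫ ι' j
  obtain ⟨β, hβ⟩ := exists_coprod_desc hZ b
  have hαβ : g = α ≫ β := coprod_hom_ext h fun j => by
    rw [← Category.assoc, hα, Category.assoc, hβ, hab]
  rw [← cancel_mono e.inv, zero_comp, hg, hαβ, Q.map_comp,
    (isZero_Q_coprod hG hZ hN).eq_of_tgt (Q.map α) 0, zero_comp, zero_comp]

/-- The localization functor to the derived category preserves coproducts. -/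
theorem nonempty_isColimit_Q (hG : IsCompactProjGenerating.{t} G) {J : Type t}
    {K : J → CochainComplex C ℤ} {X : CochainComplex C ℤ} {i : ∀ j, K j ⟶ X}
    (h : IsColimit (Cofan.mk X i)) :
    Nonempty (IsColimit (Cofan.mk (Q.obj X) fun j => Q.map (i j))) := by
  have H : ∀ (Y : DerivedCategory C) (f : ∀ j, Q.obj (K j) ⟶ Y),
      ∃ g : Q.obj X ⟶ Y, ∀ j, Q.map (i j) ≫ g = f j := by
    intro Y f
    obtain ⟨L, ⟨e⟩⟩ : ∃ L : CochainComplex C ℤ, Nonempty (Q.obj L ≅ Y) :=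
      ⟨Q.objPreimage Y, ⟨Q.objObjPreimageIso Y⟩⟩
    -- Each `f j` is a right fraction. The coproduct of the denominators is still a
    -- quasi-isomorphism, so the numerators assemble into one fraction.
    choose K' s hs g hg using fun j => right_fac (f j ≫ e.inv)
    obtain ⟨X', i', ⟨h'⟩⟩ : ∃ (Z : CochainComplex C ℤ) (ι' : ∀ j, K' j ⟶ Z),
      Nonempty (IsColimit (Cofan.mk Z ι')) := ⟨∐ K', _, ⟨coproductIsCoproduct K'⟩⟩
    obtain ⟨σ, hσ⟩ := exists_coprod_desc h' fun j => s j ≫ i j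
    obtain ⟨γ, hγ⟩ := exists_coprod_desc h' g
    have := isIso_Q_coprod hG h h' s hs σ hσ
    refine ⟨inv (Q.map σ) ≫ Q.map γ ≫ e.hom, fun j => ?_⟩
    have := hs j
    have h₁ : Q.map (i j) ≫ inv (Q.map σ) = inv (Q.map (s j)) ≫ Q.map (i' j) := by
      rw [IsIso.comp_inv_eq, Category.assoc, ← Q.map_comp, hσ, Q.map_comp, IsIso.inv_hom_id_assoc]
    rw [← cancel_mono e.inv, hg, ← Category.assoc, h₁]
    simp only [Category.assoc, Iso.hom_inv_id, Category.comp_id]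
    rw [← Q.map_comp, hγ]
  choose d hd using H
  refine ⟨Cofan.IsColimit.mk _ (fun s => d s.pt s.inj) (fun s j => hd _ _ j) fun s m hm => ?_⟩
  rw [← sub_eq_zero]
  refine Q_coprod_hom_eq_zero hG h _ fun j => ?_
  rw [Preadditive.comp_sub, hd, sub_eq_zero]
  exact hm j

theorem hasCoproducts (hG : IsCompactProjGenerating.{t} G) :
    HasCoproducts.{t} (DerivedCategory C) := by
  intro J
  have : ∀ N : J → DerivedCategory C, HasCoproduct N := fun N => by
    obtain ⟨h⟩ := nonempty_isColimit_Q hG (coproductIsCoproduct fun j => Q.objPreimage (N j))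
    have : HasCoproduct fun j => Q.obj (Q.objPreimage (N j)) := ⟨⟨⟨_, h⟩⟩⟩
    exact hasColimit_of_iso (F := Discrete.functor fun j => Q.obj (Q.objPreimage (N j)))
      (G := Discrete.functor N) (Discrete.natIso fun j => (Q.objObjPreimageIso (N j.as)).symm)
  exact ⟨fun F => hasColimit_of_iso (Discrete.natIsoFunctor (F := F))⟩

theorem finCompact_singleFunctor (hG : IsCompactProjGenerating.{t} G) {P : C} [Projective P]
    (hP : FinCompact.{t} P) (k : ℤ) : FinCompact.{t} ((singleFunctor C k).obj P) := by
  refine finCompact_of_exists fun J N => ⟨fun j => Q.obj (Q.objPreimage (N j)),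
    fun j => (Q.objObjPreimageIso (N j)).symm, _, _,
    nonempty_isColimit_Q hG (coproductIsCoproduct fun j => Q.objPreimage (N j)), fun f => ?_⟩
  obtain ⟨T, g, hf, -⟩ := exists_single_eq_sum (coproductIsCoproduct fun j => Q.objPreimage (N j)) hP k f
  exact ⟨T, g, hf⟩

end

end DerivedCategory

namespace CategoryTheory

/-- A class of compact projective objects which is closed under finite sums and retracts. -/
structure IsCompactProjClass {C : Type*} [Category* C] [Abelian C] (𝒬 : ObjectProperty C) : Prop
    where
  projective : ∀ {X : C}, 𝒬 X → Projective X
  compact : ∀ {X : C}, 𝒬 X → FinCompact.{t} X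
  zero : ∀ {X : C}, IsZero X → 𝒬 X
  biprod : ∀ {X Y : C}, 𝒬 X → 𝒬 Y → 𝒬 (X ⊞ Y)
  retract : ∀ {X Y : C}, Retract X Y → 𝒬 Y → 𝒬 X

end CategoryTheory

/-! ### The silting objects given by compact projectives in degree zero -/

namespace DerivedCategory

section

variable {C : Type u} [Category.{t} C] [Abelian C] [HasDerivedCategory.{w} C]
  {ι : Type t} {G : ι → C}

/-- The shifts of the generators `G i`, as objects of the derived category. -/
def shiftedGenerators (G : ι → C) : ObjectProperty (DerivedCategory C) := fun X =>
  ∃ i k, Nonempty (X ≅ (singleFunctor C k).obj (G i))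

theorem isCompactGenerating_shiftedGenerators [HasCoproducts.{t} C]
    (hG : IsCompactProjGenerating.{t} G) : IsCompactGenerating.{t} (shiftedGenerators G) where
  compact := by
    rintro X ⟨i, k, ⟨e⟩⟩
    have := hG.projective i
    exact finCompact_of_retract e.retract (finCompact_singleFunctor hG (hG.compact i) k)
  shift := by
    rintro X ⟨i, k, ⟨e⟩⟩ n
    exact ⟨i, k - n, ⟨(shiftFunctor _ n).mapIso e ≪≫
      ((singleFunctors C).shiftIso n (k - n) k (by lia)).app (G i)⟩⟩
  isZero X hX := isZero_of_forall_single hG X fun i k => hX _ ⟨i, k, ⟨Iso.refl _⟩⟩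
  small X := by
    obtain ⟨K, ⟨e⟩⟩ : ∃ K : CochainComplex C ℤ, Nonempty (Q.obj K ≅ X) :=
      ⟨Q.objPreimage X, ⟨Q.objObjPreimageIso X⟩⟩
    -- Indexing by chain maps, instead of morphisms of the derived category, keeps the index type in
    -- `Type t`.
    refine ⟨Σ (i : ι) (k : ℤ), (HomologicalComplex.single C (ComplexShape.up ℤ) k).obj (G i) ⟶ K,
      fun j => (singleFunctor C j.2.1).obj (G j.1), fun j => Q.map j.2.2 ≫ e.hom,
      fun j => ⟨j.1, j.2.1, ⟨Iso.refl _⟩⟩, ?_⟩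
    rintro Z ⟨i, k, ⟨e'⟩⟩ f
    have := hG.projective i
    obtain ⟨φ, hφ⟩ := exists_Q_map_eq
      (K := (HomologicalComplex.single C (ComplexShape.up ℤ) k).obj (G i)) (e'.inv ≫ f ≫ e.inv)
    refine ⟨⟨i, k, φ⟩, e'.hom, ?_⟩
    have h : f = e'.hom ≫ (e'.inv ≫ f ≫ e.inv) ≫ e.hom := by simp
    exact h.trans (congrArg (e'.hom ≫ · ≫ e.hom) hφ.symm)

theorem single_hom_eq_zero {P P' : C} [Projective P] {k l : ℤ} (hkl : k ≠ l)
    (f : (singleFunctor C k).obj P ⟶ (singleFunctor C l).obj P') : f = 0 := by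
  obtain ⟨φ, rfl⟩ := exists_Q_map_eq
    (K := (HomologicalComplex.single C (ComplexShape.up ℤ) k).obj P)
    (L := (HomologicalComplex.single C (ComplexShape.up ℤ) l).obj P') f
  have : φ = 0 := HomologicalComplex.from_single_hom_ext
    ((HomologicalComplex.isZero_single_obj_X (ComplexShape.up ℤ) l P' k hkl).eq_of_tgt _ _)
  rw [this]
  exact Q.map_zero _ _

/-- The idempotent cutting out `X` comes from one on `P`, as the single functor is fully faithful,
and it splits in `C`. -/
theorem exists_iso_single_of_retract {X : DerivedCategory C} {P : C} {k : ℤ}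
    (r : Retract X ((singleFunctor C k).obj P)) :
    ∃ (P' : C) (_ : Retract P' P), Nonempty (X ≅ (singleFunctor C k).obj P') := by
  obtain ⟨p, hp⟩ := (singleFunctor C k).map_surjective (r.r ≫ r.i)
  obtain ⟨P', i, e, h₁, h₂⟩ := IsIdempotentComplete.idempotents_split P p
    ((singleFunctor C k).map_injective (by rw [Functor.map_comp, hp]; simp))
  refine ⟨P', ⟨i, e, h₁⟩, ⟨⟨r.i ≫ (singleFunctor C k).map e, (singleFunctor C k).map i ≫ r.r, ?_, ?_⟩⟩⟩
  · rw [Category.assoc, ← Functor.map_comp_assoc, h₂, hp]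
    simp
  · rw [Category.assoc, ← Category.assoc r.r, ← hp, ← Functor.map_comp, ← Functor.map_comp, ← h₂,
      Category.assoc, h₁, Category.comp_id, h₁, CategoryTheory.Functor.map_id]

variable {𝒬 : ObjectProperty C} {H : Type*} [AddCommGroup H] (cl₀ : 𝒬.FullSubcategory → H)

open Classical in
/-- Extension of an additive invariant of `𝒬` to complexes concentrated in degree `0`. -/
noncomputable def singleClass (X : DerivedCategory C) : H :=
  if h : ∃ P : 𝒬.FullSubcategory, Nonempty (X ≅ (singleFunctor C 0).obj P.obj) then cl₀ h.choose
  else 0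

variable {cl₀}

omit [HasDerivedCategory.{w} C] in
theorem eq_of_iso_of_additive (hQ : IsCompactProjClass.{t} 𝒬)
    (h₀ : ∀ X Y Z : 𝒬.FullSubcategory, Nonempty (X.obj ≅ Y.obj ⊞ Z.obj) → cl₀ X = cl₀ Y + cl₀ Z)
    {X Y : 𝒬.FullSubcategory} (e : X.obj ≅ Y.obj) : cl₀ X = cl₀ Y := by
  obtain ⟨Z, hZ⟩ : ∃ Z : 𝒬.FullSubcategory, IsZero Z.obj :=
    ⟨⟨⊥_ C, hQ.zero initialIsInitial.isZero⟩, initialIsInitial.isZero⟩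
  -- Additivity on `X ≅ Y ⊞ 0` and `Y ≅ Y ⊞ 0` gives invariance under isomorphism.
  have e' : Y.obj ≅ Y.obj ⊞ Z.obj := ⟨biprod.inl, biprod.fst, by simp,
    biprod.hom_ext' _ _ (by simp) (hZ.eq_of_src _ _)⟩
  rw [h₀ X Y Z ⟨e ≪≫ e'⟩, ← h₀ Y Y Z ⟨e'⟩]

theorem singleClass_eq (hQ : IsCompactProjClass.{t} 𝒬)
    (h₀ : ∀ X Y Z : 𝒬.FullSubcategory, Nonempty (X.obj ≅ Y.obj ⊞ Z.obj) → cl₀ X = cl₀ Y + cl₀ Z)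
    {X : DerivedCategory C} {P : 𝒬.FullSubcategory} (e : X ≅ (singleFunctor C 0).obj P.obj) :
    singleClass cl₀ X = cl₀ P := by
  have h : ∃ P : 𝒬.FullSubcategory, Nonempty (X ≅ (singleFunctor C 0).obj P.obj) := ⟨P, ⟨e⟩⟩
  rw [singleClass, dif_pos h]
  exact eq_of_iso_of_additive hQ h₀
    ((singleFunctor C 0).preimageIso (h.choose_spec.some.symm ≪≫ e))

/-- The biproduct of single complexes. -/
noncomputable def singleBiprodIso (P P' : C) (k : ℤ) :
    (singleFunctor C k).obj P ⊞ (singleFunctor C k).obj P' ≅ (singleFunctor C k).obj (P ⊞ P') :=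
  haveI := preservesBinaryBiproducts_of_preservesBiproducts (singleFunctor C k)
  ((singleFunctor C k).mapBiprod P P').symm

/-- The invariant of complexes of the form `P[0]` with `P` in `𝒬`, given by an additive invariant
of `𝒬`. -/
noncomputable def siltingInvariant (hQ : IsCompactProjClass.{t} 𝒬)
    (h₀ : ∀ X Y Z : 𝒬.FullSubcategory, Nonempty (X.obj ≅ Y.obj ⊞ Z.obj) → cl₀ X = cl₀ Y + cl₀ Z) :
    SiltingInvariant (DerivedCategory C) H where
  P X := ∃ P : 𝒬.FullSubcategory, Nonempty (X ≅ (singleFunctor C 0).obj P.obj)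
  cl := singleClass cl₀
  zero := ⟨⟨⊥_ C, hQ.zero (initialIsInitial.isZero)⟩,
    ⟨(isZero_zero _).iso ((singleFunctor C 0).map_isZero (initialIsInitial.isZero))⟩⟩
  biprod := by
    rintro X Y ⟨P, ⟨e⟩⟩ ⟨P', ⟨e'⟩⟩
    exact ⟨⟨_, hQ.biprod P.property P'.property⟩, ⟨biprod.mapIso e e' ≪≫ singleBiprodIso _ _ _⟩⟩
  retract := by
    rintro X Y r ⟨P, ⟨e⟩⟩
    obtain ⟨P', r', ⟨e'⟩⟩ := exists_iso_single_of_retract (r.trans e.retract)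
    exact ⟨⟨P', hQ.retract r' P.property⟩, ⟨e'⟩⟩
  cl_iso := by
    rintro X Y e ⟨P, ⟨e'⟩⟩
    rw [singleClass_eq hQ h₀ e', singleClass_eq hQ h₀ (e.symm ≪≫ e')]
  cl_biprod := by
    rintro X Y ⟨P, ⟨e⟩⟩ ⟨P', ⟨e'⟩⟩
    rw [singleClass_eq hQ h₀ e, singleClass_eq hQ h₀ e', singleClass_eq hQ h₀
      (P := ⟨_, hQ.biprod P.property P'.property⟩) (biprod.mapIso e e' ≪≫ singleBiprodIso _ _ _)]
    exact h₀ _ _ _ ⟨Iso.refl _⟩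
  hom_eq_zero := by
    rintro X Y ⟨P, ⟨e⟩⟩ ⟨P', ⟨e'⟩⟩ k hk f
    have := hQ.projective P.property
    let e'' := (shiftFunctor _ k).mapIso e' ≪≫
      ((singleFunctors C).shiftIso k (-k) 0 (by lia)).app P'.obj
    have h : e.inv ≫ f ≫ e''.hom = 0 := single_hom_eq_zero (show (0 : ℤ) ≠ -k by lia) _
    rw [← cancel_epi e.inv, ← cancel_mono e''.hom, Category.assoc, h]
    simp

theorem exists_isRes_of_finCompact [HasCoproducts.{t} C] (hG : IsCompactProjGenerating.{t} G)
    (hQ : IsCompactProjClass.{t} 𝒬) (hGQ : ∀ i, 𝒬 (G i))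
    (h₀ : ∀ X Y Z : 𝒬.FullSubcategory, Nonempty (X.obj ≅ Y.obj ⊞ Z.obj) → cl₀ X = cl₀ Y + cl₀ Z)
    {M : DerivedCategory C} (hM : FinCompact.{t} M) :
    ∃ x, (siltingInvariant hQ h₀).IsRes M x := by
  have := hasCoproducts hG
  refine (isCompactGenerating_shiftedGenerators hG).exists_isRes ?_ hM
  rintro X ⟨i, k, ⟨e⟩⟩
  obtain ⟨y, hy⟩ := (SiltingInvariant.IsRes.of_P (S := siltingInvariant hQ h₀)
    (M := (singleFunctor C 0).obj (G i)) ⟨⟨_, hGQ i⟩, ⟨Iso.refl _⟩⟩).exists_shift (-k)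
  exact ⟨y, hy.of_iso (((singleFunctors C).shiftIso (-k) k 0 (by lia)).app (G i) ≪≫ e.symm)⟩

end

end DerivedCategory

/-! ### Triangle-additive invariants of compact objects -/

namespace CategoryTheory.Pretriangulated

open ZeroObject

variable {D : Type*} [Category* D] [Preadditive D] [HasZeroObject D] [HasShift D ℤ]
  [∀ n : ℤ, (shiftFunctor D n).Additive] [Pretriangulated D]

/-- An invariant of compact objects which is additive on distinguished triangles. -/
structure IsTriangleAdditive {K : Type*} [AddCommGroup K]
    (κ : (isCompactObject.{t} D).FullSubcategory → K) : Prop where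
  triangle : ∀ T ∈ distTriang D, ∀ (h₁ : isCompactObject.{t} D T.obj₁)
    (h₂ : isCompactObject.{t} D T.obj₂) (h₃ : isCompactObject.{t} D T.obj₃),
    κ ⟨T.obj₂, h₂⟩ = κ ⟨T.obj₁, h₁⟩ + κ ⟨T.obj₃, h₃⟩
  shift : ∀ (X : D) (h : isCompactObject.{t} D X) (h' : isCompactObject.{t} D (X⟦(1 : ℤ)⟧)),
    κ ⟨X⟦(1 : ℤ)⟧, h'⟩ = -κ ⟨X, h⟩

omit [HasZeroObject D] [Pretriangulated D] in
theorem isCompactObject_shift {X : D} (hX : isCompactObject.{t} D X) (n : ℤ) :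
    isCompactObject.{t} D (X⟦n⟧) :=
  (isCompactObject_iff_finCompact _).2 (finCompact_shift ((isCompactObject_iff_finCompact _).1 hX) n)

omit [HasZeroObject D] [HasShift D ℤ] [∀ (n : ℤ), (shiftFunctor D n).Additive]
  [Pretriangulated D] in
theorem isCompactObject_of_iso {X Y : D} (e : X ≅ Y) (hX : isCompactObject.{t} D X) :
    isCompactObject.{t} D Y :=
  (isCompactObject_iff_finCompact _).2
    (finCompact_of_retract e.symm.retract ((isCompactObject_iff_finCompact _).1 hX))

theorem isCompactObject_fiber {X Y Z : D} {f : X ⟶ Y} {g : Y ⟶ Z} {h : Z ⟶ X⟦(1 : ℤ)⟧}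
    (hT : Triangle.mk f g h ∈ distTriang D) (hY : isCompactObject.{t} D Y)
    (hZ : isCompactObject.{t} D Z) : isCompactObject.{t} D X := by
  rw [isCompactObject_iff_finCompact] at *
  exact finCompact_of_distTriang (inv_rot_of_distTriang _ hT) (finCompact_shift hZ (-1)) hY

namespace IsTriangleAdditive

variable {K : Type*} [AddCommGroup K] {κ : (isCompactObject.{t} D).FullSubcategory → K}
  (hκ : IsTriangleAdditive κ)

include hκ

theorem eq_of_triangle {X Y Z : D} {f : X ⟶ Y} {g : Y ⟶ Z} {h : Z ⟶ X⟦(1 : ℤ)⟧}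
    (hT : Triangle.mk f g h ∈ distTriang D) (h₁ : isCompactObject.{t} D X)
    (h₂ : isCompactObject.{t} D Y) (h₃ : isCompactObject.{t} D Z) :
    κ ⟨Y, h₂⟩ = κ ⟨X, h₁⟩ + κ ⟨Z, h₃⟩ :=
  hκ.triangle _ hT h₁ h₂ h₃

theorem iso {X Y : D} (e : X ≅ Y) (hX : isCompactObject.{t} D X) (hY : isCompactObject.{t} D Y) :
    κ ⟨X, hX⟩ = κ ⟨Y, hY⟩ := by
  have h₀ : isCompactObject.{t} D (0 : D) :=
    (isCompactObject_iff_finCompact _).2 (finCompact_zero (isZero_zero D))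
  have h₁ := hκ.eq_of_triangle (contractible_distinguished Y) hY hY h₀
  have h₂ := hκ.eq_of_triangle (distTriang_congr₁ (contractible_distinguished Y) e.symm) hX hY h₀
  rw [h₁] at h₂
  exact (add_right_cancel h₂).symm

variable {G : Type*} [AddCommGroup G] {S : SiltingInvariant D G} {Φ : G →+ K}

/-- Fibers of maps between compact objects are compact, so every syzygy has a class and additivity
applies along the whole resolution. -/
theorem eq_of_res (hP : ∀ X, S.P X → ∃ h : isCompactObject.{t} D X, κ ⟨X, h⟩ = Φ (S.cl X)) {n : ℕ}
    {M : D} {x : G} (h : S.Res n M x) (hM : isCompactObject.{t} D M) : κ ⟨M, hM⟩ = Φ x := by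
  induction h with
  | zero h => exact (hP _ h).2
  | succ hX hT _ ih =>
    obtain ⟨hX', hX⟩ := hP _ hX
    have hN := isCompactObject_fiber hT hX' hM
    rw [map_sub, ← hX, ← ih hN, hκ.eq_of_triangle hT hN hX' hM, add_sub_cancel_left]

theorem shift_nat {M : D} (hM : isCompactObject.{t} D M) (k : ℕ) :
    κ ⟨M⟦(k : ℤ)⟧, isCompactObject_shift hM k⟩ = (-1 : ℤ) ^ k • κ ⟨M, hM⟩ := by
  induction k with
  | zero =>
    rw [pow_zero, one_smul]
    exact hκ.iso ((shiftFunctorZero' D (0 : ℤ) rfl).app M) _ _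
  | succ k ih =>
    rw [pow_succ, mul_neg_one, neg_smul, ← ih, ← hκ.shift _ _ (isCompactObject_shift
      (isCompactObject_shift hM k) 1)]
    exact hκ.iso ((shiftFunctorAdd' D (k : ℤ) 1 ((k + 1 : ℕ) : ℤ) (by simp)).app M) _ _

/-- A triangle-additive invariant is determined by its values on the silting subcategory. -/
theorem eq_of_isRes (hP : ∀ X, S.P X → ∃ h : isCompactObject.{t} D X, κ ⟨X, h⟩ = Φ (S.cl X))
    {M : D} {x : G} (h : S.IsRes M x) (hM : isCompactObject.{t} D M) : κ ⟨M, hM⟩ = Φ x := by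
  obtain ⟨k, n, h⟩ := h
  have h' := hκ.eq_of_res hP h (isCompactObject_shift hM k)
  rw [hκ.shift_nat, map_zsmul] at h'
  rcases neg_one_pow_eq_or ℤ k with h | h <;> rw [h] at h' <;> simpa using h'

end IsTriangleAdditive

end CategoryTheory.Pretriangulated

/-! ### Comparison of the two Grothendieck groups -/

namespace DerivedCategory

variable {C : Type u} [Category.{t} C] [Abelian C] [HasDerivedCategory.{w} C] [HasCoproducts.{t} C]
  {ι : Type t} {G : ι → C} {𝒬 : ObjectProperty C} {R : Type} [CommRing R]

theorem isCompactObject_singleFunctor (hG : IsCompactProjGenerating.{t} G)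
    (hQ : IsCompactProjClass.{t} 𝒬) (P : 𝒬.FullSubcategory) :
    isCompactObject.{t} _ ((singleFunctor C 0).obj P.obj) :=
  have := hQ.projective P.property
  (isCompactObject_iff_finCompact _).2 (finCompact_singleFunctor hG (hQ.compact P.property) 0)

/-- The Grothendieck group of compact objects of the derived category, modulo additional
relations `W'`, is isomorphic to the Grothendieck group of `𝒬` modulo corresponding relations `W`. -/
theorem exists_linearEquiv_of_relations (hG : IsCompactProjGenerating.{t} G)
    (hQ : IsCompactProjClass.{t} 𝒬) (hGQ : ∀ i, 𝒬 (G i))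
    (W : Set (𝒬.FullSubcategory →₀ R))
    (W' : Set ((isCompactObject.{t} (DerivedCategory C)).FullSubcategory →₀ R))
    {U : Set (𝒬.FullSubcategory →₀ R)} (hU : U = directSumRelations R 𝒬 ∪ W)
    {V : Set ((isCompactObject.{t} (DerivedCategory C)).FullSubcategory →₀ R)}
    (hV : V = triangleRelations R _ ∪ W')
    (hW : ∀ r ∈ W, Finsupp.linearCombination R (fun P : 𝒬.FullSubcategory =>
      (Submodule.Quotient.mk (Finsupp.single ⟨_, isCompactObject_singleFunctor hG hQ P⟩ 1) :
        (_ →₀ R) ⧸ Submodule.span R V)) r = 0)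
    (hW' : ∀ (h₀ : ∀ X Y Z : 𝒬.FullSubcategory, Nonempty (X.obj ≅ Y.obj ⊞ Z.obj) →
        (Submodule.Quotient.mk (Finsupp.single X 1) : (_ →₀ R) ⧸ Submodule.span R U) =
          Submodule.Quotient.mk (Finsupp.single Y 1) + Submodule.Quotient.mk (Finsupp.single Z 1))
      (χ : (isCompactObject.{t} (DerivedCategory C)).FullSubcategory →
        (𝒬.FullSubcategory →₀ R) ⧸ Submodule.span R U),
      (∀ M, (siltingInvariant hQ h₀).IsRes M.obj (χ M)) →
        ∀ r ∈ W', Finsupp.linearCombination R χ r = 0) :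
    ∃ e : ((𝒬.FullSubcategory →₀ R) ⧸ Submodule.span R U) ≃ₗ[R]
        (((isCompactObject.{t} (DerivedCategory C)).FullSubcategory →₀ R) ⧸ Submodule.span R V),
      ∀ P : 𝒬.FullSubcategory, e (Submodule.Quotient.mk (Finsupp.single P 1)) =
        Submodule.Quotient.mk (Finsupp.single ⟨_, isCompactObject_singleFunctor hG hQ P⟩ 1) := by
  let H := (𝒬.FullSubcategory →₀ R) ⧸ Submodule.span R U
  let K := ((isCompactObject.{t} (DerivedCategory C)).FullSubcategory →₀ R) ⧸ Submodule.span R V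
  let cl₀ : 𝒬.FullSubcategory → H := fun P => Submodule.Quotient.mk (Finsupp.single P 1)
  let κ : (isCompactObject.{t} (DerivedCategory C)).FullSubcategory → K :=
    fun M => Submodule.Quotient.mk (Finsupp.single M 1)
  let σ : 𝒬.FullSubcategory → (isCompactObject.{t} (DerivedCategory C)).FullSubcategory :=
    fun P => ⟨_, isCompactObject_singleFunctor hG hQ P⟩
  have h₀ : ∀ X Y Z : 𝒬.FullSubcategory, Nonempty (X.obj ≅ Y.obj ⊞ Z.obj) →
      cl₀ X = cl₀ Y + cl₀ Z := by
    intro X Y Z h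
    have : Finsupp.single X 1 - Finsupp.single Y 1 - Finsupp.single Z 1 ∈ Submodule.span R U :=
      Submodule.subset_span (hU ▸ Or.inl ⟨X, Y, Z, h, rfl⟩)
    rw [← sub_eq_zero, ← sub_sub]
    exact (Submodule.Quotient.mk_eq_zero _).2 this
  have hκ : IsTriangleAdditive κ := by
    constructor
    · intro T hT h₁ h₂ h₃
      have : Finsupp.single ⟨T.obj₂, h₂⟩ 1 - Finsupp.single ⟨T.obj₁, h₁⟩ 1 -
          Finsupp.single ⟨T.obj₃, h₃⟩ 1 ∈ Submodule.span R V :=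
        Submodule.subset_span (hV ▸ Or.inl (Or.inl ⟨T, hT, h₁, h₂, h₃, rfl⟩))
      rw [← sub_eq_zero, ← sub_sub]
      exact (Submodule.Quotient.mk_eq_zero _).2 this
    · intro X h h'
      have : Finsupp.single ⟨X⟦(1 : ℤ)⟧, h'⟩ 1 + Finsupp.single ⟨X, h⟩ 1 ∈ Submodule.span R V :=
        Submodule.subset_span (hV ▸ Or.inl (Or.inr ⟨X, h, h', rfl⟩))
      rw [eq_neg_iff_add_eq_zero]
      exact (Submodule.Quotient.mk_eq_zero _).2 this
  let S := siltingInvariant hQ h₀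
  have hS : ∀ {X : DerivedCategory C} {P : 𝒬.FullSubcategory}
      (_ : X ≅ (singleFunctor C 0).obj P.obj), S.cl X = cl₀ P := singleClass_eq hQ h₀
  have hχ : ∀ M : (isCompactObject.{t} (DerivedCategory C)).FullSubcategory,
      ∃ x, S.IsRes M.obj x := fun M =>
    exists_isRes_of_finCompact hG hQ hGQ h₀ ((isCompactObject_iff_finCompact _).1 M.property)
  choose χ hχ using hχ
  -- A direct sum decomposition gives a split triangle, so `Φ` respects the direct sum relations.
  let Φ : H →ₗ[R] K := (Submodule.span R U).liftQ (Finsupp.linearCombination R (κ ∘ σ)) (by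
    rw [Submodule.span_le, hU]
    rintro r (⟨X, Y, Z, ⟨e⟩, rfl⟩ | hr)
    · have hT := distTriang_congr₂ (binaryBiproductTriangle_distinguished
        ((singleFunctor C 0).obj Y.obj) ((singleFunctor C 0).obj Z.obj))
        (singleBiprodIso _ _ _ ≪≫ (singleFunctor C 0).mapIso e.symm)
      have := hκ.eq_of_triangle hT (σ Y).property (σ X).property (σ Z).property
      simp only [SetLike.mem_coe, LinearMap.mem_ker, map_sub, Finsupp.linearCombination_single,
        one_smul, Function.comp_apply]
      rw [sub_sub, sub_eq_zero]
      exact this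
    · exact hW r hr)
  have hΦ : ∀ P, Φ (cl₀ P) = κ (σ P) := fun P =>
    (Submodule.liftQ_apply _ _ _).trans (by simp)
  -- The Euler characteristic. The triangle relations hold by the horseshoe lemma together with
  -- uniqueness.
  let Ψ : K →ₗ[R] H := (Submodule.span R V).liftQ (Finsupp.linearCombination R χ) (by
    rw [Submodule.span_le, hV]
    rintro r ((⟨T, hT, h₁, h₂, h₃, rfl⟩ | ⟨X, h, h', rfl⟩) | hr)
    · simp only [SetLike.mem_coe, LinearMap.mem_ker, map_sub, Finsupp.linearCombination_single,
        one_smul]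
      rw [sub_sub, sub_eq_zero]
      exact (hχ ⟨T.obj₂, h₂⟩).unique
        ((hχ ⟨T.obj₁, h₁⟩).of_distTriang (hχ ⟨T.obj₃, h₃⟩) (f := T.mor₁) (g := T.mor₂)
          (h := T.mor₃) hT)
    · simp only [SetLike.mem_coe, LinearMap.mem_ker, map_add, Finsupp.linearCombination_single,
        one_smul]
      rw [← eq_neg_iff_add_eq_zero]
      exact (hχ ⟨X⟦(1 : ℤ)⟧, h'⟩).unique (hχ ⟨X, h⟩).shift_one
    · exact hW' h₀ χ hχ r hr)
  have hΨ : ∀ M, Ψ (κ M) = χ M := fun M =>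
    (Submodule.liftQ_apply _ _ _).trans (by simp)
  have hP : ∀ X, S.P X → ∃ h : isCompactObject.{t} _ X, κ ⟨X, h⟩ = Φ.toAddMonoidHom (S.cl X) := by
    rintro X ⟨P, ⟨e⟩⟩
    refine ⟨isCompactObject_of_iso e.symm (σ P).property, ?_⟩
    rw [hS e]
    exact (hκ.iso e _ (σ P).property).trans (hΦ P).symm
  refine ⟨LinearEquiv.ofLinearMap Φ Ψ ?_ ?_, hΦ⟩
  -- `Φ ∘ Ψ` is the identity because a class in `K` is computed by a resolution; `Ψ ∘ Φ` is, because
  -- `P[0]` is its own resolution.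
  · refine Submodule.linearMap_qext _ (Finsupp.lhom_ext' fun M => LinearMap.ext_ring ?_)
    change Φ (Ψ (κ M)) = κ M
    rw [hΨ]
    exact (hκ.eq_of_isRes hP (hχ M) M.property).symm
  · refine Submodule.linearMap_qext _ (Finsupp.lhom_ext' fun P => LinearMap.ext_ring ?_)
    change Ψ (Φ (cl₀ P)) = cl₀ P
    rw [hΦ, hΨ]
    refine (hχ (σ P)).unique ?_
    rw [← hS (Iso.refl ((singleFunctor C 0).obj P.obj))]
    exact .of_P ⟨P, ⟨Iso.refl _⟩⟩

end DerivedCategory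

/-! ### Modules over a ring -/

namespace ModuleCat

variable {A : Type u} [Ring A]

/-- The elements with this property form a submodule containing the images of all summands. The
quotient by it receives the zero map from each summand, so it is zero; no explicit model of the
coproduct is needed. -/
theorem exists_coprodIdem_apply {J : Type*} {N : J → ModuleCat.{u} A} {X : ModuleCat.{u} A}
    {i : ∀ j, N j ⟶ X} (h : IsColimit (Cofan.mk X i)) (x : X) :
    ∃ T : Finset J, ∀ T', T ⊆ T' → (coprodIdem h T').hom x = x := by
  classical
  let S : Submodule A X :=
    { carrier := {x | ∃ T : Finset J, ∀ T', T ⊆ T' → (coprodIdem h T').hom x = x}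
      zero_mem' := ⟨∅, fun _ _ => map_zero _⟩
      add_mem' := by
        rintro x y ⟨T, hT⟩ ⟨T', hT'⟩
        exact ⟨T ∪ T', fun T'' hT'' => by
          rw [map_add, hT _ (Finset.union_subset_left hT''), hT' _ (Finset.union_subset_right hT'')]⟩
      smul_mem' := by
        rintro a x ⟨T, hT⟩
        exact ⟨T, fun T' hT' => by rw [map_smul, hT T' hT']⟩ }
  have hS : ofHom S.mkQ = 0 := coprod_hom_ext h fun j => by
    ext y
    refine (Submodule.Quotient.mk_eq_zero _).2 ⟨{j}, fun T' hT' => ?_⟩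
    exact congrArg (fun f => f.hom y) (ι_coprodIdem_of_mem h (Finset.singleton_subset_iff.1 hT'))
  exact (Submodule.Quotient.mk_eq_zero S).1 (congrArg (fun f => f.hom x) hS)

theorem finCompact_of_finite (M : ModuleCat.{u} A) [Module.Finite A M] : FinCompact.{t} M := by
  classical
  refine finCompact_of_exists_idem fun J N X i h f => ?_
  obtain ⟨s, hs⟩ := Module.Finite.fg_top (R := A) (M := M)
  choose T hT using fun m => exists_coprodIdem_apply h (f.hom m)
  refine ⟨s.biUnion T, ModuleCat.hom_ext (LinearMap.ext_on hs fun m hm => ?_)⟩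
  exact hT m _ (Finset.subset_biUnion_of_mem T hm)

theorem isCompactProjGenerating :
    IsCompactProjGenerating.{u} fun _ : PUnit.{u + 1} => ModuleCat.of A A where
  projective _ := (IsProjective.iff_projective _).1 (inferInstanceAs (Module.Projective A A))
  compact _ := finCompact_of_finite _
  isZero X hX := by
    rw [IsZero.iff_id_eq_zero]
    ext x
    have := congrArg (fun f => f.hom (1 : A)) (hX ⟨⟩ (ofHom (LinearMap.toSpanSingleton A X x)))
    simpa using this

end ModuleCat

theorem Module.finite_and_projective_of_retract {A M M' : Type*} [Ring A] [AddCommGroup M]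
    [Module A M] [AddCommGroup M'] [Module A M'] (i : M →ₗ[A] M') (r : M' →ₗ[A] M)
    (h : r ∘ₗ i = LinearMap.id) [Module.Finite A M'] [Module.Projective A M'] :
    Module.Finite A M ∧ Module.Projective A M :=
  ⟨Module.Finite.of_surjective r fun x => ⟨i x, LinearMap.congr_fun h x⟩,
    Module.Projective.of_split i r h⟩

theorem isCompactProjClass_fgProjective (A : Type u) [Ring A] :
    IsCompactProjClass.{u} (fgProjective A) := by
  refine ⟨fun {X} h => ?_, fun {X} h => ?_, fun {X} h => ?_, fun {X Y} hX hY => ?_,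
    fun {X Y} r h => ?_⟩
  · exact (IsProjective.iff_projective _).1 h.2
  · have := h.1
    exact ModuleCat.finCompact_of_finite X
  · have := ModuleCat.subsingleton_of_isZero h
    have : Module.Free A X := Module.Free.of_subsingleton A X
    exact ⟨inferInstance, Module.Projective.of_free⟩
  · obtain ⟨_, _⟩ := hX
    obtain ⟨_, _⟩ := hY
    refine Module.finite_and_projective_of_retract ((biprod.fst : X ⊞ Y ⟶ X).hom.prod (biprod.snd : X ⊞ Y ⟶ Y).hom)
      ((biprod.inl : X ⟶ X ⊞ Y).hom.coprod (biprod.inr : Y ⟶ X ⊞ Y).hom) ?_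
    exact congrArg ModuleCat.Hom.hom (biprod.total (X := X) (Y := Y))
  · obtain ⟨_, _⟩ := h
    exact Module.finite_and_projective_of_retract r.i.hom r.r.hom (congrArg ModuleCat.Hom.hom r.retract)

/-! ### Graded modules -/

namespace GrMod

variable {A : Type u} [Ring A] {𝒜 : ℤ → AddSubgroup A}

section Coproducts

open DirectSum

variable {J : Type u} (N : J → GrMod 𝒜)

open Classical in
/-- The direct sum of a family of graded modules. -/
noncomputable def dsum : GrMod 𝒜 where
  carrier := ⨁ j, (N j).carrier
  gr i :=
    { carrier := {x | ∀ j, x j ∈ (N j).gr i}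
      zero_mem' := fun j => zero_mem _
      add_mem' := fun hx hy j => add_mem (hx j) (hy j)
      neg_mem' := fun hx j => neg_mem (hx j) }
  isInternal := by
    refine isInternal_of_proj _ (fun i => DFinsupp.mapRange.addMonoidHom fun j => (N j).proj i)
      ?_ ?_ ?_
    · intro i x hx
      exact DFinsupp.ext fun j => (N j).proj_of_mem (hx j)
    · intro i k hik x hx
      exact DFinsupp.ext fun j => (N j).proj_of_mem_ne hik (hx j)
    · intro x
      induction x using DirectSum.induction_on with
      | zero => exact zero_mem _
      | of j m =>
        induction m using (N j).induction_gr with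
        | h0 => rw [map_zero]; exact zero_mem _
        | h i m hm =>
          refine AddSubgroup.mem_iSup_of_mem i fun k => ?_
          by_cases hk : k = j
          · subst hk; rwa [of_eq_same]
          · rw [of_eq_of_ne _ _ _ hk]; exact zero_mem _
        | ha a b ha hb => rw [map_add]; exact add_mem ha hb
      | add x y hx hy => exact add_mem hx hy
  smul_mem ha hm j := (N j).smul_mem ha (hm j)

open Classical in
/-- The inclusion of a summand. -/
noncomputable def dsumι (j : J) : N j ⟶ dsum N :=
  have h : ∀ (i : ℤ) (m : (N j).carrier), m ∈ (N j).gr i → ∀ k,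
      DirectSum.of (fun j => (N j).carrier) j m k ∈ (N k).gr i := fun i m hm k => by
    by_cases hk : k = j
    · subst hk; rwa [of_eq_same]
    · rw [of_eq_of_ne _ _ _ hk]; exact zero_mem _
  ⟨DirectSum.lof A J (fun j => (N j).carrier) j, h⟩

/-- The projection to a summand. -/
noncomputable def dsumProj (j : J) : dsum N ⟶ N j :=
  ⟨DirectSum.component A J (fun j => (N j).carrier) j, fun _ _ hx => hx j⟩

variable {N}

theorem exists_dsum_eq_sum (x : (dsum N).carrier) :
    ∃ T : Finset J, ∀ T', T ⊆ T' → ∑ j ∈ T', (dsumι N j).lin ((dsumProj N j).lin x) = x := by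
  classical
  refine ⟨DFinsupp.support (β := fun j => (N j).carrier) x, fun T' hT' => ?_⟩
  refine Eq.trans (Finset.sum_subset hT' fun j _ hj => ?_).symm
    (DirectSum.sum_support_of (β := fun j => (N j).carrier) x)
  have : (dsumProj N j).lin x = 0 := DFinsupp.notMem_support_iff.1 hj
  rw [this, map_zero]

open Classical in
/-- The linear map from a direct sum given by morphisms from the summands. -/
noncomputable def dsumLin {M : GrMod 𝒜} (f : ∀ j, N j ⟶ M) : (dsum N).carrier →ₗ[A] M.carrier :=
  DirectSum.toModule A J M.carrier fun j => (f j).lin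

theorem dsumLin_ι {M : GrMod 𝒜} (f : ∀ j, N j ⟶ M) (j : J) (m : (N j).carrier) :
    dsumLin f ((dsumι N j).lin m) = (f j).lin m := by
  classical
  exact DirectSum.toModule_lof (M := fun j => (N j).carrier) (φ := fun j => (f j).lin) A j m

/-- The universal property of the direct sum. -/
noncomputable def dsumDesc {M : GrMod 𝒜} (f : ∀ j, N j ⟶ M) : dsum N ⟶ M :=
  ⟨dsumLin f, fun i x hx => by
    obtain ⟨T, hT⟩ := exists_dsum_eq_sum x
    rw [← hT T subset_rfl, map_sum]
    refine sum_mem fun j _ => ?_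
    rw [dsumLin_ι]
    exact (f j).map_mem i _ ((dsumProj N j).map_mem i x hx)⟩

theorem ι_dsumDesc {M : GrMod 𝒜} (f : ∀ j, N j ⟶ M) (j : J) : dsumι N j ≫ dsumDesc f = f j :=
  GrMod.hom_ext fun m => dsumLin_ι f j m

theorem dsum_hom_ext {M : GrMod 𝒜} {f g : dsum N ⟶ M} (h : ∀ j, dsumι N j ≫ f = dsumι N j ≫ g) :
    f = g := by
  ext x
  obtain ⟨T, hT⟩ := exists_dsum_eq_sum x
  rw [← hT T subset_rfl, map_sum, map_sum]
  exact Finset.sum_congr rfl fun j _ => LinearMap.congr_fun (congrArg Hom.lin (h j)) _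

variable (N) in
/-- The direct sum is a coproduct. -/
noncomputable def dsumIsColimit : IsColimit (Cofan.mk (dsum N) (dsumι N)) :=
  Cofan.IsColimit.mk _ (fun s => dsumDesc s.inj) (fun s j => ι_dsumDesc s.inj j) fun s _ hm =>
    dsum_hom_ext fun j => (hm j).trans (ι_dsumDesc s.inj j).symm

instance : HasCoproducts.{u} (GrMod 𝒜) :=
  hasCoproducts_of_colimit_cofans (fun N => Cofan.mk (dsum N) (dsumι N)) fun N => dsumIsColimit N

theorem sum_lin {M M' : GrMod 𝒜} (T : Finset J) (f : J → (M ⟶ M')) (m : M.carrier) :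
    (∑ j ∈ T, f j).lin m = ∑ j ∈ T, (f j).lin m :=
  map_sum (AddMonoidHom.mk' (fun g : M ⟶ M' => g.lin m) fun _ _ => rfl) f T

theorem finCompact_of_finite (M : GrMod 𝒜) [Module.Finite A M.carrier] : FinCompact.{u} M := by
  classical
  refine finCompact_of_exists fun J N => ⟨N, fun j => Iso.refl _, dsum N, dsumι N,
    ⟨dsumIsColimit N⟩, fun f => ?_⟩
  obtain ⟨s, hs⟩ := Module.Finite.fg_top (R := A) (M := M.carrier)
  choose T hT using fun m => exists_dsum_eq_sum (f.lin m)
  refine ⟨s.biUnion T, fun j => f ≫ dsumProj N j, Hom.ext (LinearMap.ext_on hs fun m hm => ?_)⟩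
  rw [sum_lin]
  exact (hT m _ (Finset.subset_biUnion_of_mem T hm)).symm

end Coproducts

/-! Generators -/

section Generators

variable (𝒜) [GradedRing 𝒜]

/-- The graded ring as a graded module. -/
def regular : GrMod 𝒜 where
  carrier := A
  gr := 𝒜
  isInternal := DirectSum.Decomposition.isInternal 𝒜
  smul_mem ha hm := SetLike.mul_mem_graded ha hm

variable {𝒜}

/-- The morphism from a shift of the regular module given by a homogeneous element. -/
def ofElem (M : GrMod 𝒜) {n : ℤ} {m : M.carrier} (hm : m ∈ M.gr n) :
    (shift 𝒜 n).obj (regular 𝒜) ⟶ M :=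
  ⟨LinearMap.toSpanSingleton A M.carrier m, fun i a ha => by
    have h : ∀ a : A, a ∈ 𝒜 (i - n) → a • m ∈ M.gr (i - n + n) := fun a ha => M.smul_mem ha hm
    rw [sub_add_cancel] at h
    exact h a ha⟩

theorem isZero_of_forall_regular (X : GrMod 𝒜)
    (hX : ∀ (n : ℤ) (f : (shift 𝒜 n).obj (regular 𝒜) ⟶ X), f = 0) : IsZero X := by
  rw [IsZero.iff_id_eq_zero]
  ext x
  change x = 0
  induction x using X.induction_gr with
  | h0 => rfl
  | h i m hm =>
    have : (1 : A) • m = 0 := LinearMap.congr_fun (congrArg Hom.lin (hX i (X.ofElem hm))) (1 : A)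
    rwa [one_smul] at this
  | ha a b ha hb => rw [ha, hb, add_zero]

end Generators

/-! Graded projective modules -/

section Projective

variable [GradedRing 𝒜]

omit [GradedRing 𝒜] in
theorem proj_smul (M : GrMod 𝒜) {i : ℤ} {a : A} (ha : a ∈ 𝒜 i) (j : ℤ) (m : M.carrier) :
    M.proj (i + j) (a • m) = a • M.proj j m := by
  induction m using M.induction_gr with
  | h0 => simp
  | h k m hm =>
    by_cases hjk : j = k
    · subst hjk
      rw [M.proj_of_mem hm, M.proj_of_mem (M.smul_mem ha hm)]
    · rw [M.proj_of_mem_ne hjk hm, M.proj_of_mem_ne (by lia) (M.smul_mem ha hm), smul_zero]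
  | ha x y hx hy => simp only [smul_add, map_add, hx, hy]

/-- Every linear map from a graded module agrees with a morphism of graded modules, up to
components of nonzero degree. -/
theorem exists_hom_of_linearMap {P M : GrMod 𝒜} (l : P.carrier →ₗ[A] M.carrier) :
    ∃ f : P ⟶ M, ∀ i, ∀ p ∈ P.gr i, f.lin p = M.proj i (l p) := by
  classical
  let := P.isInternal.chooseDecomposition
  let l₀ : P.carrier →+ M.carrier :=
    (DirectSum.toAddMonoid fun i => (M.proj i).comp (l.toAddMonoidHom.comp (P.gr i).subtype)).comp
      (DirectSum.decomposeAddEquiv P.gr).toAddMonoidHom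
  have h₀ : ∀ i, ∀ p ∈ P.gr i, l₀ p = M.proj i (l p) := fun i p hp => by
    change DirectSum.toAddMonoid _ (DirectSum.decompose P.gr p) = _
    rw [DirectSum.decompose_of_mem P.gr hp, DirectSum.toAddMonoid_of]
    rfl
  have h₁ : ∀ (a : A) (p : P.carrier), l₀ (a • p) = a • l₀ p := by
    intro a p
    induction a using DirectSum.Decomposition.inductionOn 𝒜 with
    | zero => simp
    | @homogeneous i a =>
      induction p using P.induction_gr with
      | h0 => simp
      | h j p hp =>
        rw [h₀ _ _ hp, h₀ _ _ (P.smul_mem a.2 hp), map_smul, M.proj_smul a.2]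
      | ha x y hx hy => simp only [smul_add, map_add, hx, hy]
    -- Linearity of the degree-zero part only has to be checked on homogeneous scalars and elements,
    -- where it is `proj_smul`.
    | add a b ha hb => simp only [add_smul, map_add, ha, hb]
  exact ⟨⟨{ l₀ with map_smul' := h₁ }, fun i p hp => by
    change l₀ p ∈ _
    rw [h₀ i p hp]
    exact M.proj_mem _ _⟩, h₀⟩

/-- An ungraded lift exists, and its degree-zero part is still a lift because the maps being lifted
preserve degrees. -/
theorem projective_of_projective (P : GrMod 𝒜) [Module.Projective A P.carrier] :
    Projective P := by
  constructor
  intro E X f e he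
  obtain ⟨l, hl⟩ := Module.projective_lifting_property e.lin f.lin (surjective_of_epi e)
  obtain ⟨g, hg⟩ := exists_hom_of_linearMap (P := P) (M := E) l
  refine ⟨g, GrMod.hom_ext fun p => ?_⟩
  induction p using P.induction_gr with
  | h0 => simp
  | h i p hp =>
    have hl' : e.lin (l p) = f.lin p := LinearMap.congr_fun hl p
    change e.lin (g.lin p) = f.lin p
    rw [hg i p hp, ← proj_naturality, hl', X.proj_of_mem (f.map_mem i p hp)]
  | ha x y hx hy => rw [map_add, map_add, hx, hy]

end Projective

theorem grFgProjective_shift {P : GrMod 𝒜} (hP : grFgProjective 𝒜 P) (n : ℤ) :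
    grFgProjective 𝒜 ((shift 𝒜 n).obj P) := hP

variable [GradedRing 𝒜]

theorem grFgProjective_regular : grFgProjective 𝒜 (regular 𝒜) :=
  ⟨inferInstanceAs (Module.Finite A A), inferInstanceAs (Module.Projective A A)⟩

theorem isCompactProjGenerating : IsCompactProjGenerating.{u}
    fun n : ULift.{u} ℤ => (shift 𝒜 n.down).obj (regular 𝒜) where
  projective n := by
    have := (grFgProjective_shift (grFgProjective_regular (𝒜 := 𝒜)) n.down).2
    exact projective_of_projective _
  compact n := by
    have := (grFgProjective_shift (grFgProjective_regular (𝒜 := 𝒜)) n.down).1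
    exact finCompact_of_finite _
  isZero X hX := isZero_of_forall_regular X fun n => hX ⟨n⟩

end GrMod

theorem isCompactProjClass_grFgProjective {A : Type u} [Ring A] (𝒜 : ℤ → AddSubgroup A)
    [GradedRing 𝒜] : IsCompactProjClass.{u} (grFgProjective 𝒜) := by
  refine ⟨fun {X} h => ?_, fun {X} h => ?_, fun {X} h => ?_, fun {X Y} hX hY => ?_,
    fun {X Y} r h => ?_⟩
  · have := h.2
    exact GrMod.projective_of_projective X
  · have := h.1
    exact GrMod.finCompact_of_finite X
  · have hX : ∀ x : X.carrier, x = 0 :=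
      LinearMap.congr_fun (congrArg GrMod.Hom.lin ((IsZero.iff_id_eq_zero X).1 h))
    have : Subsingleton X.carrier := ⟨fun x y => (hX x).trans (hX y).symm⟩
    have : Module.Free A X.carrier := Module.Free.of_subsingleton A X.carrier
    exact ⟨inferInstance, Module.Projective.of_free⟩
  · obtain ⟨_, _⟩ := hX
    obtain ⟨_, _⟩ := hY
    refine Module.finite_and_projective_of_retract ((biprod.fst : X ⊞ Y ⟶ X).lin.prod (biprod.snd : X ⊞ Y ⟶ Y).lin)
      ((biprod.inl : X ⟶ X ⊞ Y).lin.coprod (biprod.inr : Y ⟶ X ⊞ Y).lin) ?_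
    exact congrArg GrMod.Hom.lin (biprod.total (X := X) (Y := Y))
  · obtain ⟨_, _⟩ := h
    exact Module.finite_and_projective_of_retract r.i.lin r.r.lin (congrArg GrMod.Hom.lin r.retract)

/-! ### The grading shift on the derived category and the final theorem -/

namespace GrMod

variable {A : Type u} [Ring A] {𝒜 : ℤ → AddSubgroup A} [HasDerivedCategory.{w} (GrMod 𝒜)]

/-- The grading shift of a complex concentrated in degree `0`. -/
noncomputable def shiftSingleIso (n : ℤ) (P : GrMod 𝒜) :
    (shift 𝒜 n).mapDerivedCategory.obj ((DerivedCategory.singleFunctor (GrMod 𝒜) 0).obj P) ≅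
      (DerivedCategory.singleFunctor (GrMod 𝒜) 0).obj ((shift 𝒜 n).obj P) :=
  ((shift 𝒜 n).mapDerivedCategorySingleFunctor 0).app P

end GrMod

theorem mainTheorem6 :
    -- the ungraded case
    (∀ (A : Type u) [Ring A] [IsNoetherianRing A] [HasDerivedCategory.{w} (ModuleCat.{u} A)],
      ∃ (hc : ∀ P : (fgProjective A).FullSubcategory,
          compactDg A ((DerivedCategory.singleFunctor (ModuleCat.{u} A) 0).obj P.obj))
        (e : ClassicalK0 A ≃+ DgK0 A),
        ∀ P : (fgProjective A).FullSubcategory,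
          e (ClassicalK0.mk A P) = DgK0.mk A ⟨_, hc P⟩) ∧
    -- the graded case
    (∀ (A : Type u) [Ring A] (𝒜 : ℤ → AddSubgroup A) [GradedRing 𝒜]
      [HasDerivedCategory.{w} (GrMod 𝒜)], IsGradedNoetherian 𝒜 →
      ∃ (hc : ∀ P : (grFgProjective 𝒜).FullSubcategory,
          compactGrDg 𝒜 ((DerivedCategory.singleFunctor (GrMod 𝒜) 0).obj P.obj))
        (e : GrClassicalK0 𝒜 ≃ₗ[ℤ[T;T⁻¹]] GrDgK0 𝒜),
        ∀ P : (grFgProjective 𝒜).FullSubcategory,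
          e (GrClassicalK0.mk 𝒜 P) = GrDgK0.mk 𝒜 ⟨_, hc P⟩) := by
  constructor
  · intro A _ _ _
    have hG := ModuleCat.isCompactProjGenerating (A := A)
    have hQ := isCompactProjClass_fgProjective A
    obtain ⟨e, he⟩ := DerivedCategory.exists_linearEquiv_of_relations (R := ℤ) hG hQ
      (fun _ => ⟨inferInstanceAs (Module.Finite A A), inferInstanceAs (Module.Projective A A)⟩)
      ∅ ∅ (Set.union_empty _).symm (Set.union_empty _).symm (fun r hr => hr.elim)
      (fun _ _ _ r hr => hr.elim)
    exact ⟨DerivedCategory.isCompactObject_singleFunctor hG hQ, e.toAddEquiv, he⟩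
  · intro A _ 𝒜 _ _ _
    have hG := GrMod.isCompactProjGenerating (𝒜 := 𝒜)
    have hQ := isCompactProjClass_grFgProjective 𝒜
    refine Exists.elim (DerivedCategory.exists_linearEquiv_of_relations (R := ℤ[T;T⁻¹]) hG hQ
      (fun n => GrMod.grFgProjective_shift GrMod.grFgProjective_regular n.down)
      (shiftRelations (grFgProjective 𝒜) (GrMod.shift 𝒜))
      (shiftRelations (compactGrDg 𝒜) fun n => (GrMod.shift 𝒜 n).mapDerivedCategory)
      rfl rfl ?_ ?_) fun e he => ⟨DerivedCategory.isCompactObject_singleFunctor hG hQ, e, he⟩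
    · rintro r ⟨n, X, Y, ⟨i⟩, rfl⟩
      rw [map_sub, Finsupp.linearCombination_single, Finsupp.linearCombination_single, one_smul,
        ← Submodule.Quotient.mk_smul, Finsupp.smul_single, smul_eq_mul, mul_one,
        ← Submodule.Quotient.mk_sub, Submodule.Quotient.mk_eq_zero]
      -- The single functor carries `P{n}` to the grading shift of `P[0]`, so this is one of the
      -- imposed shift relations.
      exact Submodule.subset_span (Or.inr ⟨n, _, _, ⟨(DerivedCategory.singleFunctor _ 0).mapIso i ≪≫
        (GrMod.shiftSingleIso n X.obj).symm⟩, rfl⟩)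
    · rintro h₀ χ hχ r ⟨n, X, Y, ⟨i⟩, rfl⟩
      rw [map_sub, Finsupp.linearCombination_single, Finsupp.linearCombination_single, one_smul,
        sub_eq_zero]
      -- Multiplication by `q^n`. The grading shift acts in this way on classes of silting objects,
      -- hence by `IsRes.map` on all Euler characteristics.
      let ψ := DistribSMul.toAddMonoidHom (GrClassicalK0 𝒜) (LaurentPolynomial.T n : ℤ[T;T⁻¹])
      refine (hχ Y).unique (.of_iso ((hχ X).map (GrMod.shift 𝒜 n).mapDerivedCategory ψ ?_ ?_) i.symm)
      · rintro M ⟨P, ⟨j⟩⟩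
        exact ⟨⟨_, GrMod.grFgProjective_shift P.property n⟩,
          ⟨(GrMod.shift 𝒜 n).mapDerivedCategory.mapIso j ≪≫ GrMod.shiftSingleIso n P.obj⟩⟩
      · rintro M ⟨P, ⟨j⟩⟩
        let P' : (grFgProjective 𝒜).FullSubcategory :=
          ⟨_, GrMod.grFgProjective_shift P.property n⟩
        refine (DerivedCategory.singleClass_eq hQ h₀ (P := P') ((GrMod.shift 𝒜
          n).mapDerivedCategory.mapIso j ≪≫ GrMod.shiftSingleIso n P.obj)).trans ?_
        refine Eq.trans ?_ (congrArg ψ (DerivedCategory.singleClass_eq hQ h₀ j).symm)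
        have h : Finsupp.single P' 1 - Finsupp.single P (LaurentPolynomial.T n) ∈
            Submodule.span ℤ[T;T⁻¹] (directSumRelations ℤ[T;T⁻¹] (grFgProjective 𝒜) ∪
              shiftRelations (grFgProjective 𝒜) (GrMod.shift 𝒜)) :=
          Submodule.subset_span (Or.inr ⟨n, P, P', ⟨Iso.refl _⟩, rfl⟩)
        rw [← Submodule.Quotient.eq] at h
        refine h.trans ?_
        change _ = (LaurentPolynomial.T n : ℤ[T;T⁻¹]) • (GrClassicalK0.mk 𝒜 P)
        rw [GrClassicalK0.mk, ← Submodule.Quotient.mk_smul, Finsupp.smul_single, smul_eq_mul, mul_one]
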